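/- Let $T^A$ ($A=1,\dots,8$) be the generators of $SU(3)$ in the fundamental representation, with $\mathrm{tr}(T^AT^B)=\tfrac12\delta_{AB}$. Let $a_A,a_A^\dagger$ be bosonic and $f_A,f_A^\dagger$ fermionic annihilation and creation operators, $|0\rangle$ the Fock vacuum, $a=a_AT^A$, $a^\dagger=a^\dagger_AT^A$, $f^\dagger=f^\dagger_AT^A$ the operator-valued matrices, and $(O)=\mathrm{tr}\,O$. Let $$H=(a^\dagger a)+2-\tfrac12(a^\dagger a^\dagger)-\tfrac12(aa).$$ For the two fermionic bricks $C_1^\dagger=(f^\dagger a^\dagger)$ and $C_2^\dagger=(f^\dagger a^\dagger a^\dagger)$ put $|j,k;b\rangle=C_b^\dagger\,(a^\dagger a^\dagger)^j(a^\dagger a^\dagger a^\dagger)^k|0\rangle$, a state with $2j+3k+b$ bosonic quanta. For $N\in\mathbb N$ let $\mathcal H_N$ be the span of the states with $2j+3k+b\le N$, and let $H_N$ be the cut Hamiltonian on $\mathcal H_N$, that is, $H$ followed by the projection onto the states with at most $N$ bosonic quanta. Let $L_n^\alpha=\mathcal L_n^\alpha/\Gamma(n+\alpha+1)$, where $\mathcal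 L_n^\alpha$ is the generalized Laguerre polynomial. For the parity "odd" let $b_t=1$ for even $t$ and $b_t=2$ for odd $t$; for the parity "even" let $b_t=2$ for even $t$ and $b_t=1$ for odd $t$. Put $\alpha_t=3t+3+b_t$, $\chi_t=-\tfrac12(t+1)$ if $b_t=1$ and $\chi_t=-\tfrac32(t+1)$ if $b_t=2$, $\mu_t=-\tfrac38(t+1)(t+2)$, and define the mixing coefficients of the given parity by $\Gamma_{m,y}=0$ for $y>m$, $\Gamma_{m,m}=1$ and $$\Gamma_{m,y}=\frac{4(\chi_y\Gamma_{m,y+1}+\mu_y\Gamma_{m,y+2})}{\alpha_m^2-\alpha_y^2}\qquad(y<m).$$ Consider, for $\kappa\ge0$, the families $g^1_\kappa,g^2_\kappa$ (odd parity) and $f^1_\kappa,f^2_\kappa$ (even parity). A state belongs to a family if it is a combination of states $|j,k;b\rangle$ whose number of bosonic quanta has the parity of the family, the maximal number $k$ of cubic bricks occurring in it is $2\kappa,\ 2\kappa+1,\ 2\kappa+1,\ 2\kappa$, respectively, and the basis states with this maximal $k$ have the brick $(f^\dagger a^\dagger)$, $(f^\dagger a^\dagger a^\dagger)$, $(f^\dagger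 a^\dagger)$, $(f^\dagger a^\dagger a^\dagger)$, respectively. Let the upper index be $\alpha=6\kappa+4,\ 6\kappa+8,\ 6\kappa+7,\ 6\kappa+5$, the exponent $\nu=3\kappa+\tfrac12,\ 3\kappa+\tfrac52,\ 3\kappa+2,\ 3\kappa+1$ and $d=\max\big(0,\lfloor\tfrac12(N-6\kappa-c)\rfloor+1\big)$ with $c=1,5,4,2$, respectively. Put $$|E,\kappa\rangle=(2E)^{\nu}e^{-E}\sum_{n=0}^{d-1}L_n^{\alpha}(2E)\,\overline{|n\rangle},$$ where $\overline{|n\rangle}$ is, for $g^1_\kappa,g^2_\kappa,f^1_\kappa,f^2_\kappa$ respectively, $$|n,2\kappa;1\rangle+\sum_{p=1}^{\kappa}\Big(\Gamma^{odd}_{2\kappa,2\kappa-2p+1}|n+3p-2,2\kappa-2p+1;2\rangle+\Gamma^{odd}_{2\kappa,2\kappa-2p}|n+3p,2\kappa-2p;1\rangle\Big),$$ $$|n,2\kappa+1;2\rangle+\sum_{p=1}^{\kappa+1}\Gamma^{odd}_{2\kappa+1,2\kappa-2p+2}|n+3p-1,2\kappa-2p+2;1\rangle+\sum_{p=1}^{\kappa}\Gamma^{odd}_{2\kappa+1,2\kappa-2p+1}|n+3p,2\kappa-2p+1;2\rangle,$$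 $$|n,2\kappa+1;1\rangle+\sum_{p=0}^{\kappa}\Gamma^{even}_{2\kappa+1,2\kappa-2p}|n+3p+1,2\kappa-2p;2\rangle+\sum_{p=1}^{\kappa}\Gamma^{even}_{2\kappa+1,2\kappa-2p+1}|n+3p,2\kappa-2p+1;1\rangle,$$ $$|n,2\kappa;2\rangle+\sum_{p=1}^{\kappa}\Big(\Gamma^{even}_{2\kappa,2\kappa-2p+1}|n+3p-1,2\kappa-2p+1;1\rangle+\Gamma^{even}_{2\kappa,2\kappa-2p}|n+3p,2\kappa-2p;2\rangle\Big).$$ Then, for every cut-off $N$: (1) The states $|j,k;b\rangle$ are linearly independent. (2) In every family the quantization condition $L_d^{\alpha}(2E)=0$ has exactly $d$ distinct real solutions $E_1,\dots,E_d$, all positive. For each of them $|E_m,\kappa\rangle$ is an eigenstate of $H_N$ with energy $E_m$ and belongs to the family. Conversely, the energy of any eigenstate of $H_N$ that belongs to the family satisfies the quantization condition of the family. (3) The states $|E_m,\kappa\rangle$ of all families together form a basis of $\mathcal H_N$, and every eigenstate of $H_N$ with energy $E$ is a linear combination of those among them that have energy $E$. (4) The spectrum of $H_N$, that is, the set of all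 $E\in\mathbb C$ for which a nonzero eigenstate exists, is the set of roots of $$\Theta_N(E)=\Big[\prod_{j=0}^{\lfloor (N-1)/3\rfloor}L^{3j+4}_{\lfloor (N-3j-1)/2\rfloor+1}(2E)\Big]\Big[\prod_{k=0}^{\lfloor (N-2)/3\rfloor}L^{3k+5}_{\lfloor (N-3k-2)/2\rfloor+1}(2E)\Big],$$ where a product with a negative upper limit is $1$. -/

import Mathlib

/-- The generators `T^A = λ_A / 2` of `SU(3)` in the fundamental representation (`λ_A` the
Gell-Mann matrices), normalised by `tr (T^A T^B) = δ_{AB} / 2`. -/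
noncomputable def generator : Fin 8 → Matrix (Fin 3) (Fin 3) ℂ :=
  ![(1 / 2 : ℂ) • !![0, 1, 0; 1, 0, 0; 0, 0, 0],
    (1 / 2 : ℂ) • !![0, -Complex.I, 0; Complex.I, 0, 0; 0, 0, 0],
    (1 / 2 : ℂ) • !![1, 0, 0; 0, -1, 0; 0, 0, 0],
    (1 / 2 : ℂ) • !![0, 0, 1; 0, 0, 0; 1, 0, 0],
    (1 / 2 : ℂ) • !![0, 0, -Complex.I; 0, 0, 0; Complex.I, 0, 0],
    (1 / 2 : ℂ) • !![0, 0, 0; 0, 0, 1; 0, 1, 0],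
    (1 / 2 : ℂ) • !![0, 0, 0; 0, 0, -Complex.I; 0, Complex.I, 0],
    (1 / (2 * Real.sqrt 3 : ℝ) : ℂ) • !![1, 0, 0; 0, 1, 0; 0, 0, -2]]

/-- States with finitely many quanta of the eight bosonic oscillators: the polynomial `p` is the
state `p(a†)|0⟩`. Thus `a†_A` is multiplication by the variable `X_A`, `a_A` is `∂/∂X_A`, and the
Fock vacuum is `1`. -/
abbrev BosonFock : Type := MvPolynomial (Fin 8) ℂ

/-- The sector with one fermion: the tuple `ψ` is the state `∑_A f†_A ψ_A(a†)|0⟩`. -/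
abbrev OneFermionFock : Type := Fin 8 → BosonFock

/-- The bosonic creation operator `a†_A` on the one-fermion sector. -/
noncomputable def creationOp (A : Fin 8) : Module.End ℂ OneFermionFock :=
  (LinearMap.mulLeft ℂ (MvPolynomial.X A : BosonFock)).compLeft (Fin 8)

/-- The bosonic annihilation operator `a_A` on the one-fermion sector. -/
noncomputable def annihilationOp (A : Fin 8) : Module.End ℂ OneFermionFock :=
  (MvPolynomial.pderiv (R := ℂ) A).toLinearMap.compLeft (Fin 8)

/-- The operator-valued matrix `a†_{ij} = a†_A T^A_{ij}`. -/
noncomputable def creationMatrix : Matrix (Fin 3) (Fin 3) (Module.End ℂ OneFermionFock) :=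
  Matrix.of fun i j => ∑ A, generator A i j • creationOp A

/-- The operator-valued matrix `a_{ij} = a_A T^A_{ij}`. -/
noncomputable def annihilationMatrix : Matrix (Fin 3) (Fin 3) (Module.End ℂ OneFermionFock) :=
  Matrix.of fun i j => ∑ A, generator A i j • annihilationOp A

/-- The Hamiltonian `H = tr(a†a) + 2 - tr(a†a†)/2 - tr(aa)/2` on the one-fermion sector. -/
noncomputable def hamiltonian : Module.End ℂ OneFermionFock :=
  (creationMatrix * annihilationMatrix).trace + (2 : ℂ) • 1
    - (1 / 2 : ℂ) • (creationMatrix * creationMatrix).trace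
    - (1 / 2 : ℂ) • (annihilationMatrix * annihilationMatrix).trace

/-- The orthogonal projection of the one-fermion sector onto the states with at most `N` bosonic
quanta. -/
noncomputable def quantaCutoff (N : ℕ) : Module.End ℂ OneFermionFock :=
  (∑ i ∈ Finset.range (N + 1),
    (MvPolynomial.homogeneousComponent i : BosonFock →ₗ[ℂ] BosonFock)).compLeft (Fin 8)

/-- The two fermionic bricks with one fermion, `(f†a†)` and `(f†a†a†)`. -/
inductive FermionicBrick : Type
  | fa
  | faa

/-- The number of bosonic creation operators in a fermionic brick. -/
def FermionicBrick.bosons : FermionicBrick → ℕ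
  | .fa => 1
  | .faa => 2

/-- The matrix `a†_{ij}` as a matrix of polynomials in the creation operators. -/
noncomputable def brickMatrix : Matrix (Fin 3) (Fin 3) BosonFock :=
  Matrix.of fun i j => ∑ A, MvPolynomial.C (generator A i j) * MvPolynomial.X A

/-- The state `C† (a†a†)^j (a†a†a†)^k |0⟩`, where `C†` is the fermionic brick `b`; the coefficient
of `f†_A` in the brick `(f† a† ⋯ a†)` is `tr (T^A a† ⋯ a†)`. -/
noncomputable def brickState (b : FermionicBrick) (j k : ℕ) : OneFermionFock := fun A =>
  ((generator A).map MvPolynomial.C * brickMatrix ^ b.bosons).trace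
    * (brickMatrix ^ 2).trace ^ j * (brickMatrix ^ 3).trace ^ k

/-- The number of bosonic quanta of `brickState b j k`. -/
def brickQuanta (b : FermionicBrick) (j k : ℕ) : ℕ := 2 * j + 3 * k + b.bosons

/-- The one-fermion state space at cut-off `N`. -/
noncomputable def cutSpace (N : ℕ) : Submodule ℂ OneFermionFock :=
  Submodule.span ℂ {ψ | ∃ b j k, brickQuanta b j k ≤ N ∧ ψ = brickState b j k}

/-- `ψ` is an eigenstate, of energy `E`, of the Hamiltonian restricted to the cut-off space. -/
def IsCutEigenstate (N : ℕ) (E : ℂ) (ψ : OneFermionFock) : Prop :=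
  ψ ∈ cutSpace N ∧ ψ ≠ 0 ∧ quantaCutoff N (hamiltonian ψ) = E • ψ

/-- The generalized Laguerre polynomial of degree `n` and upper index `α`. -/
noncomputable def laguerrePoly (α n : ℕ) : Polynomial ℝ :=
  ∑ i ∈ Finset.range (n + 1),
    Polynomial.C ((-1) ^ i * ((n + α).choose (n - i) : ℝ) / (i.factorial : ℝ)) * Polynomial.X ^ i

/-- The rescaled Laguerre polynomial `L_n^α`, the Laguerre polynomial divided by `Γ(n + α + 1)`. -/
noncomputable def soninePoly (α n : ℕ) : Polynomial ℝ :=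
  Polynomial.C (1 / ((n + α).factorial : ℝ)) * laguerrePoly α n

/-- The parity of the number of bosonic quanta. -/
inductive QuantaParity : Type
  | odd
  | even

/-- The fermionic brick that accompanies `t` cubic bricks in a state of given parity. -/
def chainBrick (P : QuantaParity) (t : ℕ) : FermionicBrick :=
  match P with
  | .odd => if Even t then .fa else .faa
  | .even => if Even t then .faa else .fa

/-- The Laguerre index `α_t`. -/
def chainIndex (P : QuantaParity) (t : ℕ) : ℕ := 3 * t + 3 + (chainBrick P t).bosons

/-- The nearest-neighbour mixing `χ_t`. -/
noncomputable def chainChi (P : QuantaParity) (t : ℕ) : ℝ :=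
  match chainBrick P t with
  | .fa => -(1 / 2) * (t + 1)
  | .faa => -(3 / 2) * (t + 1)

/-- The next-to-nearest-neighbour mixing `μ_t`. -/
noncomputable def chainMu (t : ℕ) : ℝ := -(3 / 8) * (t + 1) * (t + 2)

/-- The mixing coefficients `Γ_{m,y}`: they vanish for `y > m`, equal `1` for `y = m`, and
`Γ_{m,y} = 4 (χ_y Γ_{m,y+1} + μ_y Γ_{m,y+2}) / (α_m² - α_y²)` for `y < m`. -/
noncomputable def mixing (P : QuantaParity) (m y : ℕ) : ℝ :=
  if m < y then 0
  else if y = m then 1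
  else 4 * (chainChi P y * mixing P m (y + 1) + chainMu y * mixing P m (y + 2))
    / ((chainIndex P m : ℝ) ^ 2 - (chainIndex P y : ℝ) ^ 2)
termination_by m + 1 - y

/-- The four types of families: `g¹, g²` (odd number of quanta) and `f¹, f²` (even number). -/
inductive FamilyType : Type
  | g1
  | g2
  | f1
  | f2

namespace FamilyType

/-- The parity of the number of quanta in a family. -/
def parity : FamilyType → QuantaParity
  | g1 => .odd
  | g2 => .odd
  | f1 => .even
  | f2 => .even

/-- The maximal number of cubic bricks in the family with label `κ`. -/
def maxCubic : FamilyType → ℕ → ℕ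
  | g1, κ => 2 * κ
  | g2, κ => 2 * κ + 1
  | f1, κ => 2 * κ + 1
  | f2, κ => 2 * κ

/-- The fermionic brick of the basis states with the maximal number of cubic bricks. -/
def leadingBrick : FamilyType → FermionicBrick
  | g1 => .fa
  | g2 => .faa
  | f1 => .fa
  | f2 => .faa

/-- The upper index of the Laguerre polynomials of the family with label `κ`. -/
def upperIndex : FamilyType → ℕ → ℕ
  | g1, κ => 6 * κ + 4
  | g2, κ => 6 * κ + 8
  | f1, κ => 6 * κ + 7
  | f2, κ => 6 * κ + 5

/-- The power of `2E` in the normalisation. -/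
noncomputable def normExponent : FamilyType → ℕ → ℝ
  | g1, κ => 3 * κ + 1 / 2
  | g2, κ => 3 * κ + 5 / 2
  | f1, κ => 3 * κ + 2
  | f2, κ => 3 * κ + 1

/-- The number of solutions in the family with label `κ` at cut-off `N`, with `0` in place of a
negative value. -/
def solutionCount (N : ℕ) : FamilyType → ℕ → ℕ
  | g1, κ => (((N : ℤ) - 6 * κ - 1) / 2 + 1).toNat
  | g2, κ => (((N : ℤ) - 6 * κ - 5) / 2 + 1).toNat
  | f1, κ => (((N : ℤ) - 6 * κ - 4) / 2 + 1).toNat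
  | f2, κ => (((N : ℤ) - 6 * κ - 2) / 2 + 1).toNat

/-- The combination of basis states that multiplies `L_n(2E)` in the family with label `κ`. -/
noncomputable def dressedState : FamilyType → ℕ → ℕ → OneFermionFock
  | g1, κ, n => brickState .fa n (2 * κ)
      + ∑ p ∈ Finset.Icc 1 κ,
        ((mixing .odd (2 * κ) (2 * κ - 2 * p + 1) : ℂ) •
            brickState .faa (n + 3 * p - 2) (2 * κ - 2 * p + 1)
          + (mixing .odd (2 * κ) (2 * κ - 2 * p) : ℂ) •
            brickState .fa (n + 3 * p) (2 * κ - 2 * p))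
  | g2, κ, n => brickState .faa n (2 * κ + 1)
      + ∑ p ∈ Finset.Icc 1 (κ + 1),
        (mixing .odd (2 * κ + 1) (2 * κ + 2 - 2 * p) : ℂ) •
          brickState .fa (n + 3 * p - 1) (2 * κ + 2 - 2 * p)
      + ∑ p ∈ Finset.Icc 1 κ,
        (mixing .odd (2 * κ + 1) (2 * κ - 2 * p + 1) : ℂ) •
          brickState .faa (n + 3 * p) (2 * κ - 2 * p + 1)
  | f1, κ, n => brickState .fa n (2 * κ + 1)
      + ∑ p ∈ Finset.Icc 0 κ,
        (mixing .even (2 * κ + 1) (2 * κ - 2 * p) : ℂ) •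
          brickState .faa (n + 3 * p + 1) (2 * κ - 2 * p)
      + ∑ p ∈ Finset.Icc 1 κ,
        (mixing .even (2 * κ + 1) (2 * κ - 2 * p + 1) : ℂ) •
          brickState .fa (n + 3 * p) (2 * κ - 2 * p + 1)
  | f2, κ, n => brickState .faa n (2 * κ)
      + ∑ p ∈ Finset.Icc 1 κ,
        ((mixing .even (2 * κ) (2 * κ - 2 * p + 1) : ℂ) •
            brickState .fa (n + 3 * p - 1) (2 * κ - 2 * p + 1)
          + (mixing .even (2 * κ) (2 * κ - 2 * p) : ℂ) •
            brickState .faa (n + 3 * p) (2 * κ - 2 * p))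

/-- The energies allowed by the quantization condition `L_d^α(2E) = 0` of the family with label
`κ` at cut-off `N`, where `d` is the number of solutions. -/
def energies (N : ℕ) (F : FamilyType) (κ : ℕ) : Set ℝ :=
  {E | (soninePoly (F.upperIndex κ) (F.solutionCount N κ)).eval (2 * E) = 0}

/-- The state of energy `E` in the family with label `κ` at cut-off `N`. -/
noncomputable def eigenstate (N : ℕ) (F : FamilyType) (κ : ℕ) (E : ℝ) : OneFermionFock :=
  (((2 * E) ^ F.normExponent κ * Real.exp (-E) : ℝ) : ℂ) •
    ∑ n ∈ Finset.range (F.solutionCount N κ),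
      (((soninePoly (F.upperIndex κ) n).eval (2 * E) : ℝ) : ℂ) • F.dressedState κ n

/-- `ψ` is composed of basis states whose number of quanta has the parity of the family, the
maximal number of cubic bricks in them is that of the family, and the basis states with this
number of cubic bricks contain the leading fermionic brick of the family. -/
def Contains (F : FamilyType) (κ : ℕ) (ψ : OneFermionFock) : Prop :=
  ∃ c : FermionicBrick × ℕ × ℕ →₀ ℂ,
    ψ = c.sum (fun s x => x • brickState s.1 s.2.1 s.2.2) ∧
    (∀ s ∈ c.support,
      (match F.parity with
        | .odd => Odd (brickQuanta s.1 s.2.1 s.2.2)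
        | .even => Even (brickQuanta s.1 s.2.1 s.2.2)) ∧
      s.2.2 ≤ F.maxCubic κ ∧
      (s.2.2 = F.maxCubic κ → s.1 = F.leadingBrick)) ∧
    ∃ s ∈ c.support, s.2.2 = F.maxCubic κ

end FamilyType

/-- The set of all solutions at cut-off `N`: a family and an energy allowed in it. -/
abbrev CutSolution (N : ℕ) : Type :=
  {s : FamilyType × ℕ × ℝ // s.2.2 ∈ s.1.energies N s.2.1}

/-- The polynomial `Θ_N(E)` of the one-fermion sector. -/
noncomputable def thetaPoly (N : ℕ) : Polynomial ℝ :=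
  (∏ j ∈ Finset.range (((N : ℤ) - 1) / 3 + 1).toNat,
    (soninePoly (3 * j + 4) (((N : ℤ) - 3 * j - 1) / 2 + 1).toNat).comp
      (Polynomial.C 2 * Polynomial.X)) *
  (∏ k ∈ Finset.range (((N : ℤ) - 2) / 3 + 1).toNat,
    (soninePoly (3 * k + 5) (((N : ℤ) - 3 * k - 2) / 2 + 1).toNat).comp
      (Polynomial.C 2 * Polynomial.X))

/-! In the polynomial model `tr(a†a)` is half the Euler operator, `tr(a†a†)` is multiplication by
`quadInv`, and `tr(aa)` is half the Laplacian. On a homogeneous state of degree q this gives H =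
(q/2 + 2) - `quadCreation`/2 - `laplacian`/4 (`hamiltonian_of_homogeneous`), so everything rests on
the Laplacian of the brick states. It lowers the number of quadratic bricks by one, or trades one or
two cubic bricks for quadratic ones; removing one cubic brick also swaps the fermionic brick. Parity
and number of cubic bricks fix the fermionic brick, so each parity is a single chain indexed by the
number of cubic bricks.

The coefficients Γ remove the trading terms. In `chainState P m n` the summand with y cubic bricks
has s = (α_m - α_y)/2 extra quadratic bricks, and (n+s)(n+s+α_y) = n(n+α_m) + (α_m² - α_y²)/4. The
recursion for Γ cancels the last term against the trading terms, so the Laplacian just lowers n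
(`laplacian_chainState`). For fixed m, H is then tridiagonal in n, with the coefficients of the
three-term recurrence of the rescaled Laguerre polynomials. Applying H to a truncated Laguerre sum
leaves two boundary terms: the cut-off kills one, and the quantization condition kills the other
(`hamiltonian_chainVector`, `cutHamiltonian_chainVector`).

Completeness is a count. The degree-d polynomial has d distinct real roots, because a symmetric
Jacobi matrix has these roots as its simple eigenvalues (`soninePoly_card_roots`). Hence each family
has as many eigenstates as chain states below the cut-off. Chain states are unitriangular over the
brick states, which are independent because they can be told apart on companion matrices
(`brickFunctional_brickState`). The converse statements and the spectrum follow by expanding an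
eigenstate in the resulting eigenbasis. -/

/-! ### Rescaled Laguerre polynomials: recurrence and simplicity of the roots -/

section Laguerre

open Polynomial

/-- The factor 1/(n+α)! cancels the numerator of the binomial coefficient, so the remaining
dependence on n is (n-i)!. The recurrences can then be checked coefficient by coefficient. -/
theorem soninePoly_coeff (α n i : ℕ) : (soninePoly α n).coeff i =
    if i ≤ n then (-1) ^ i / ((i.factorial : ℝ) * (n - i).factorial * (α + i).factorial)
    else 0 := by
  unfold soninePoly laguerrePoly
  rw [coeff_C_mul, finsetSum_coeff]
  simp only [coeff_C_mul_X_pow, Finset.sum_ite_eq, Finset.mem_range, Nat.lt_succ_iff]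
  split_ifs with h
  · rw [Nat.cast_choose ℝ (by omega : n - i ≤ n + α), show n + α - (n - i) = α + i by omega]
    have h1 : ((n + α).factorial : ℝ) ≠ 0 := by positivity
    field_simp
  · simp

theorem soninePoly_natDegree (α n : ℕ) : (soninePoly α n).natDegree = n := by
  refine natDegree_eq_of_le_of_coeff_ne_zero ?_ ?_
  · refine natDegree_le_iff_coeff_eq_zero.2 fun i hi => ?_
    rw [soninePoly_coeff, if_neg (by omega)]
  · rw [soninePoly_coeff, if_pos le_rfl]
    positivity

theorem soninePoly_ne_zero (α n : ℕ) : soninePoly α n ≠ 0 := by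
  intro h
  have h1 := soninePoly_coeff α n n
  rw [h, if_pos le_rfl, coeff_zero] at h1
  exact (by positivity : (-1 : ℝ) ^ n /
    ((n.factorial : ℝ) * (n - n).factorial * (α + n).factorial) ≠ 0) h1.symm

theorem soninePoly_zero (α : ℕ) : soninePoly α 0 = C (1 / (α.factorial : ℝ)) := by
  simp [soninePoly, laguerrePoly]

theorem soninePoly_one (α : ℕ) :
    C (((1 : ℝ) + α)) * soninePoly α 1 = (C ((1 : ℝ) + α) - X) * soninePoly α 0 := by
  rw [soninePoly_zero, sub_mul]
  ext i
  rw [coeff_C_mul, coeff_sub, coeff_C_mul, soninePoly_coeff, coeff_mul_C]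
  have h := Nat.factorial_succ α
  rcases i with _ | _ | i
  · simp
  · simp [h]
    have : (α.factorial : ℝ) ≠ 0 := by positivity
    have : (1 + α : ℝ) ≠ 0 := by positivity
    have : (α + 1 : ℝ) ≠ 0 := by positivity
    field_simp
    ring
  · simp [coeff_X]

/-- In this normalisation the coefficient of the lowest term is the constant 1, matching the
constant weight with which H creates a quadratic brick. -/
theorem soninePoly_recurrence (α n : ℕ) :
    C (((n : ℝ) + 2) * (n + 2 + α)) * soninePoly α (n + 2) =
      (C (2 * (n : ℝ) + 3 + α) - X) * soninePoly α (n + 1) - soninePoly α n := by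
  rw [sub_mul]
  ext i
  rw [coeff_C_mul, coeff_sub, coeff_sub, coeff_C_mul]
  rcases i with _ | i
  · rw [coeff_X_mul_zero]
    simp only [soninePoly_coeff, Nat.zero_le, if_true, Nat.factorial_succ, Nat.sub_zero]
    push_cast
    have : (n.factorial : ℝ) ≠ 0 := by positivity
    have : ((α + 0).factorial : ℝ) ≠ 0 := by positivity
    have : (n + 1 : ℝ) ≠ 0 := by positivity
    have : (n + 1 + 1 : ℝ) ≠ 0 := by positivity
    field_simp
    ring
  rw [coeff_X_mul]
  simp only [soninePoly_coeff]
  have h1 : (i.factorial : ℝ) ≠ 0 := by positivity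
  have h2 : ((α + i).factorial : ℝ) ≠ 0 := by positivity
  have h3 : (i + 1 : ℝ) ≠ 0 := by positivity
  have h4 : (α + i + 1 : ℝ) ≠ 0 := by positivity
  have h5 : (α + (i + 1)).factorial = (α + i + 1) * (α + i).factorial := Nat.factorial_succ _
  rcases lt_trichotomy i n with h | rfl | h
  · obtain ⟨r, rfl⟩ := Nat.exists_eq_add_of_lt h
    rw [if_pos (by omega), if_pos (by omega), if_pos (by omega), if_pos (by omega),
      show i + r + 1 + 2 - (i + 1) = r + 2 by omega, show i + r + 1 + 1 - (i + 1) = r + 1 by omega,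
      show i + r + 1 + 1 - i = r + 2 by omega, show i + r + 1 - (i + 1) = r by omega, h5]
    simp only [Nat.factorial_succ]
    push_cast
    have : (r.factorial : ℝ) ≠ 0 := by positivity
    have : (r + 1 : ℝ) ≠ 0 := by positivity
    have : (r + 1 + 1 : ℝ) ≠ 0 := by positivity
    field_simp
    ring
  · rw [if_pos (by omega), if_pos (by omega), if_pos (by omega), if_neg (by omega),
      show i + 2 - (i + 1) = 1 by omega, show i + 1 - (i + 1) = 0 by omega,
      show i + 1 - i = 1 by omega, h5]
    simp only [Nat.factorial_succ, Nat.factorial_zero]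
    push_cast
    field_simp
    ring
  · rw [if_neg (by omega : ¬ i + 1 ≤ n + 1), if_neg (by omega : ¬ i + 1 ≤ n)]
    by_cases h' : i = n + 1
    · subst h'
      rw [if_pos (by omega), if_pos (by omega), h5,
        show n + 2 - (n + 1 + 1) = 0 by omega, show n + 1 - (n + 1) = 0 by omega]
      simp only [Nat.factorial_succ, Nat.factorial_zero] at *
      push_cast at *
      field_simp
      ring
    · rw [if_neg (by omega), if_neg (by omega)]
      ring

/-- The coefficients alternate in sign, so for x ≤ 0 no term is negative and the constant term is
positive. This is what makes every energy positive. -/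
theorem soninePoly_eval_pos (α n : ℕ) {x : ℝ} (hx : x ≤ 0) : 0 < (soninePoly α n).eval x := by
  rw [eval_eq_sum_range, soninePoly_natDegree, Finset.sum_range_succ']
  refine add_pos_of_nonneg_of_pos (Finset.sum_nonneg fun i hi => ?_) ?_
  · rw [soninePoly_coeff]
    split_ifs
    · rw [div_eq_mul_inv, mul_right_comm, ← mul_pow]
      have : 0 ≤ -1 * x := by linarith
      positivity
    · simp
  · rw [soninePoly_coeff, if_pos (Nat.zero_le _)]
    simp only [pow_zero, mul_one]
    positivity

/-- The symmetric tridiagonal matrix of the orthonormal Laguerre polynomials. -/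
noncomputable def laguerreJacobi (α d : ℕ) : Matrix (Fin d) (Fin d) ℝ := fun i j =>
  if i = j then 2 * (i : ℝ) + 1 + α
  else if (j : ℕ) = i + 1 then -√(((i : ℝ) + 1) * (i + 1 + α))
  else if (i : ℕ) = j + 1 then -√(((j : ℝ) + 1) * (j + 1 + α))
  else 0

theorem laguerreJacobi_isHermitian (α d : ℕ) : (laguerreJacobi α d).IsHermitian := by
  ext i j
  simp only [laguerreJacobi, Matrix.conjTranspose_apply, star_trivial]
  rcases lt_trichotomy (i : ℕ) j with h | h | h
  · have hij : i ≠ j := fun h' => by omega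
    rw [if_neg hij, if_neg hij.symm]
    split_ifs <;> first | rfl | omega
  · have : i = j := Fin.ext h
    subst this
    rfl
  · have hij : i ≠ j := fun h' => by omega
    rw [if_neg hij, if_neg hij.symm]
    split_ifs <;> first | rfl | omega

/-- Extending the vector by zero to all of ℕ gives the last row the same form as the others. The
condition v d = 0 later becomes the root condition. -/
theorem laguerreJacobi_mulVec (α d : ℕ) (v : ℕ → ℝ) (hv : ∀ n, d ≤ n → v n = 0) (i : Fin d) :
    (laguerreJacobi α d).mulVec (fun j => v j) i =
      (2 * ((i : ℕ) : ℝ) + 1 + α) * v i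
        - √((((i : ℕ) : ℝ) + 1) * ((i : ℕ) + 1 + α)) * v (i + 1)
        - (if (i : ℕ) = 0 then 0 else √(((i : ℕ) : ℝ) * ((i : ℕ) + α)) * v (i - 1)) := by
  obtain ⟨i, hi⟩ := i
  have key : (laguerreJacobi α d).mulVec (fun j => v j) ⟨i, hi⟩ = ∑ j ∈ Finset.range d,
      ((if j = i then (2 * (i : ℝ) + 1 + α) * v i else 0)
        - (if j = i + 1 then √(((i : ℝ) + 1) * (i + 1 + α)) * v (i + 1) else 0)
        - (if i = j + 1 then √(((j : ℝ) + 1) * (j + 1 + α)) * v j else 0)) := by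
    rw [Finset.sum_range]
    simp only [Matrix.mulVec, dotProduct]
    refine Finset.sum_congr rfl fun j _ => ?_
    obtain ⟨j, hj⟩ := j
    simp only [laguerreJacobi, Fin.mk.injEq]
    split_ifs <;> first | (exfalso; omega) | (subst_vars; ring)
  rw [key, Finset.sum_sub_distrib, Finset.sum_sub_distrib, Finset.sum_ite_eq',
    Finset.sum_ite_eq', if_pos (Finset.mem_range.2 hi)]
  congr 1
  · congr 1
    split_ifs with h
    · rfl
    · rw [hv (i + 1) (by simpa using h), mul_zero]
  · rcases i with _ | i
    · simp
    · rw [Finset.sum_eq_single i]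
      · simp
      · intro b _ hb
        rw [if_neg (by omega)]
      · intro h
        exact absurd (Finset.mem_range.2 (by omega : i < d)) h

/-- The components of an eigenvector of the Jacobi matrix are multiples of the orthonormal Laguerre
polynomials; the component beyond the last one vanishes. -/
theorem laguerreJacobi_eigenvector (α d : ℕ) (v : ℕ → ℝ) (hv : ∀ n, d ≤ n → v n = 0) (x : ℝ)
    (h : (laguerreJacobi α d).mulVec (fun j => v j) = x • fun j : Fin d => v j) :
    ∃ K : ℝ, ∀ n ≤ d, v n =
      K * √(n.factorial * (n + α).factorial) * (soninePoly α n).eval x := by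
  set b : ℕ → ℝ := fun m => √(((m : ℝ) + 1) * (m + 1 + α)) with hbdef
  set q : ℕ → ℝ := fun m => √(m.factorial * ((m + α).factorial : ℝ)) with hqdef
  have hq : ∀ m : ℕ, q (m + 1) = b m * q m := by
    intro m
    simp only [hbdef, hqdef]
    rw [← Real.sqrt_mul (by positivity), Nat.factorial_succ,
      show m + 1 + α = (m + α) + 1 by ring, Nat.factorial_succ]
    push_cast
    ring_nf
  have hs : ∀ m : ℕ, b m * b m = ((m : ℝ) + 1) * (m + 1 + α) :=
    fun m => Real.mul_self_sqrt (by positivity)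
  have hp : ∀ m : ℕ, b m ≠ 0 := fun m => by simp only [hbdef]; positivity
  have hq0 : q 0 ≠ 0 := by simp only [hqdef]; positivity
  have row0 : 0 < d → x * v 0 = (1 + α) * v 0 - b 0 * v 1 := by
    intro hd
    have := congrFun h ⟨0, hd⟩
    rw [laguerreJacobi_mulVec α d v hv] at this
    simpa [hbdef] using this.symm
  have row : ∀ i, i + 1 < d → x * v (i + 1) = (2 * (i : ℝ) + 3 + α) * v (i + 1)
        - b (i + 1) * v (i + 2) - b i * v i := by
    intro i hi
    have := congrFun h ⟨i + 1, hi⟩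
    rw [laguerreJacobi_mulVec α d v hv] at this
    simp only [Nat.add_eq_zero_iff, one_ne_zero, and_false, if_false, Nat.add_sub_cancel,
      Pi.smul_apply, smul_eq_mul] at this
    rw [← this]
    simp only [hbdef]
    push_cast
    ring
  have h2 : (α.factorial : ℝ) ≠ 0 := by positivity
  -- The constant is dictated by n = 0, where the polynomial equals 1/α!.
  refine ⟨v 0 * α.factorial / q 0, fun n hn => ?_⟩
  change v n = _ * q n * _
  set K := v 0 * α.factorial / q 0 with hK
  have base : v 0 = K * q 0 * (soninePoly α 0).eval x := by
    rw [hK, soninePoly_zero, eval_C]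
    field_simp
  induction n using Nat.strong_induction_on with
  | _ n ih =>
  rcases n with _ | _ | n
  · exact base
  · have r := row0 (by omega)
    have hrec := congrArg (eval x) (soninePoly_one α)
    simp only [eval_mul, eval_C, eval_sub, eval_X] at hrec
    apply mul_left_cancel₀ (hp 0)
    rw [zero_add, hq 0]
    have s0 := hs 0
    push_cast at s0
    linear_combination (1 + α - x) * base + r - K * q 0 * (soninePoly α 1).eval x * s0
      - K * q 0 * hrec
  · have r := row n (by omega)
    have i0 := ih n (by omega) (by omega)
    have i1 := ih (n + 1) (by omega) (by omega)
    have hrec := congrArg (eval x) (soninePoly_recurrence α n)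
    simp only [eval_mul, eval_C, eval_sub, eval_X] at hrec
    apply mul_left_cancel₀ (hp (n + 1))
    rw [hq (n + 1), hq n]
    rw [hq n] at i1
    have s0 := hs (n + 1)
    push_cast at s0
    linear_combination (2 * n + 3 + α - x) * i1 - b n * i0 + r
      - K * b n * q n * (soninePoly α (n + 2)).eval x * s0 - K * b n * q n * hrec

/-- Every member of the Laguerre family has as many distinct real roots as its degree. -/
theorem soninePoly_card_roots (α d : ℕ) : (soninePoly α d).roots.toFinset.card = d := by
  refine le_antisymm ((Multiset.toFinset_card_le _).trans
    ((card_roots' _).trans (soninePoly_natDegree α d).le)) ?_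
  set hJ := laguerreJacobi_isHermitian α d
  set w : Fin d → ℕ → ℝ := fun i n => if h : n < d then hJ.eigenvectorBasis i ⟨n, h⟩ else 0 with hw
  have hwf : ∀ i, (fun j : Fin d => w i j) = ⇑(hJ.eigenvectorBasis i) := by
    intro i
    ext j
    simp [hw]
  have hw0 : ∀ i n, d ≤ n → w i n = 0 := fun i n hn => by simp [hw, hn]
  have hex : ∀ i, ∃ K : ℝ, ∀ n ≤ d, w i n = K * √(n.factorial * (n + α).factorial) *
      (soninePoly α n).eval (hJ.eigenvalues i) := by
    intro i
    apply laguerreJacobi_eigenvector α d (w i) (hw0 i)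
    rw [hwf i]
    exact hJ.mulVec_eigenvectorBasis i
  choose K hKw using hex
  have hne : ∀ i, (hJ.eigenvectorBasis i) ≠ 0 := fun i => hJ.eigenvectorBasis.orthonormal.ne_zero i
  have hK : ∀ i, K i ≠ 0 := by
    intro i hKi
    apply hne i
    ext j
    rw [← congrFun (hwf i) j]
    simp [hKw i j j.2.le, hKi]
  -- The formula for the components also holds at n = d, where the extended eigenvector vanishes;
  -- the other two factors are nonzero.
  have hroot : ∀ i, (soninePoly α d).eval (hJ.eigenvalues i) = 0 := by
    intro i
    have := hKw i d le_rfl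
    rw [hw0 i d le_rfl] at this
    have hq : √((d.factorial : ℝ) * (d + α).factorial) ≠ 0 := by positivity
    rw [eq_comm, mul_eq_zero, mul_eq_zero] at this
    exact (this.resolve_left (not_or.2 ⟨hK i, hq⟩))
  -- An eigenvalue determines its eigenvector up to scale, so two orthogonal unit eigenvectors
  -- cannot share one.
  have hinj : Function.Injective hJ.eigenvalues := by
    intro i j hij
    by_contra hne'
    have horth : inner ℝ (hJ.eigenvectorBasis i) (hJ.eigenvectorBasis j) = 0 :=
      hJ.eigenvectorBasis.orthonormal.2 hne'
    have hprop : hJ.eigenvectorBasis j = (K j / K i) • hJ.eigenvectorBasis i := by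
      ext n
      have h1 := congrFun (hwf i) n
      have h2 := congrFun (hwf j) n
      rw [PiLp.smul_apply, ← h1, ← h2]
      simp only [hKw i n n.2.le, hKw j n n.2.le, hij, smul_eq_mul]
      have := hK i
      field_simp
    rw [hprop, inner_smul_right, real_inner_self_eq_norm_sq,
      hJ.eigenvectorBasis.orthonormal.1 i] at horth
    have := div_ne_zero (hK j) (hK i)
    simp [this] at horth
  calc d = (Finset.univ.image hJ.eigenvalues).card := by
        rw [Finset.card_image_of_injective _ hinj, Finset.card_univ, Fintype.card_fin]
    _ ≤ _ := by
        refine Finset.card_le_card fun x hx => ?_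
        obtain ⟨i, -, rfl⟩ := Finset.mem_image.1 hx
        simp [soninePoly_ne_zero, hroot i]

theorem soninePoly_splits (α d : ℕ) : (soninePoly α d).Splits := by
  rw [splits_iff_card_roots, soninePoly_natDegree]
  refine le_antisymm ((card_roots' _).trans (soninePoly_natDegree α d).le) ?_
  calc d = _ := (soninePoly_card_roots α d).symm
    _ ≤ _ := Multiset.toFinset_card_le _

/-- All complex roots are real. -/
theorem soninePoly_aeval_eq_zero (α d : ℕ) {z : ℂ} (hz : aeval z (soninePoly α d) = 0) :
    ∃ x : ℝ, (soninePoly α d).eval x = 0 ∧ z = x := by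
  have h := (soninePoly_splits α d).eq_prod_roots
  rw [h] at hz
  rw [map_mul, aeval_C, map_multiset_prod, mul_eq_zero] at hz
  rcases hz with hz | hz
  · simp [soninePoly_ne_zero] at hz
  · rw [Multiset.prod_eq_zero_iff, Multiset.map_map, Multiset.mem_map] at hz
    obtain ⟨x, hx, hzx⟩ := hz
    refine ⟨x, (mem_roots'.1 hx).2, ?_⟩
    simpa [sub_eq_zero] using hzx

end Laguerre

/-! ### SU(3) trace identities and the quadratic and cubic invariants -/

section Bricks

open MvPolynomial

theorem trace_generator_mul (A B : Fin 8) :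
    (generator A * generator B).trace = if A = B then 1 / 2 else 0 := by
  have h3 : ((√3 : ℝ) : ℂ) ^ 2 = 3 := by
    rw [← Complex.ofReal_pow, Real.sq_sqrt (by norm_num)]; norm_num
  have h0 : ((√3 : ℝ) : ℂ) ≠ 0 := by
    intro h; rw [h] at h3; norm_num at h3
  fin_cases A <;> fin_cases B <;>
    simp [generator, Matrix.trace_fin_three] <;>
    (try ring_nf) <;> (try field_simp) <;> (try simp [h3])

/-- Noncommutative R is allowed so that the same identity serves the operator matrices in H and the
polynomial matrix of the bricks. -/
theorem trace_generator_sum_mul {R : Type*} [Ring R] [Algebra ℂ R] (f g : Fin 8 → R) :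
    (((Matrix.of fun i j => ∑ A, generator A i j • f A : Matrix (Fin 3) (Fin 3) R) *
      (Matrix.of fun i j => ∑ A, generator A i j • g A : Matrix (Fin 3) (Fin 3) R))).trace =
      ∑ A, (1 / 2 : ℂ) • (f A * g A) := by
  have h1 : ∀ A, (1 / 2 : ℂ) • (f A * g A) =
      ∑ B, (generator A * generator B).trace • (f A * g B) := by
    intro A
    simp [trace_generator_mul]
  have h2 : ∀ A B, (generator A * generator B).trace • (f A * g B) =
      ∑ i, ∑ j, (generator A i j • f A) * (generator B j i • g B) := by
    intro A B
    simp only [Matrix.trace, Matrix.diag, Matrix.mul_apply, Finset.sum_smul, smul_mul_smul_comm]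
  simp only [h1, h2]
  simp only [Matrix.trace, Matrix.diag, Matrix.mul_apply, Matrix.of_apply,
    Finset.sum_mul_sum]
  calc _ = ∑ i, ∑ A, ∑ j, ∑ B, (generator A i j • f A) * (generator B j i • g B) :=
        Finset.sum_congr rfl fun i _ => Finset.sum_comm
    _ = ∑ A, ∑ i, ∑ j, ∑ B, (generator A i j • f A) * (generator B j i • g B) := Finset.sum_comm
    _ = ∑ A, ∑ i, ∑ B, ∑ j, (generator A i j • f A) * (generator B j i • g B) :=
        Finset.sum_congr rfl fun A _ => Finset.sum_congr rfl fun i _ => Finset.sum_comm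
    _ = _ := Finset.sum_congr rfl fun A _ => Finset.sum_comm

/-- The quadratic invariant `(a†a†)`. -/
noncomputable def quadInv : BosonFock := (brickMatrix ^ 2).trace

/-- The cubic invariant `(a†a†a†)`. -/
noncomputable def cubicInv : BosonFock := (brickMatrix ^ 3).trace

/-- The coefficient of `f†_A` in the brick `(f†a†a†)`. -/
noncomputable def quadVec (A : Fin 8) : BosonFock :=
  ((generator A).map C * brickMatrix ^ 2).trace

theorem brickMatrix_eq_smul :
    brickMatrix = Matrix.of fun i j => ∑ A, generator A i j • (X A : BosonFock) := by
  ext1 i j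
  simp [brickMatrix, MvPolynomial.smul_eq_C_mul]

theorem quadInv_eq : quadInv = ∑ A, (1 / 2 : ℂ) • (X A * X A : BosonFock) := by
  rw [quadInv, pow_two, brickMatrix_eq_smul, trace_generator_sum_mul]

theorem trace_generator_mul_brickMatrix (A : Fin 8) :
    ((generator A).map C * brickMatrix).trace = (1 / 2 : ℂ) • (X A : BosonFock) := by
  -- A single generator is the linear combination with coefficient 1 at A.
  have h := trace_generator_sum_mul (R := BosonFock) (Pi.single A 1) X
  rw [← brickMatrix_eq_smul] at h
  have h2 : (Matrix.of fun i j => ∑ B, generator B i j • (Pi.single A 1 : Fin 8 → BosonFock) B) =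
      (generator A).map C := by
    ext1 i j
    simp [Pi.single_apply, MvPolynomial.smul_eq_C_mul]
  rw [h2] at h
  rw [h, Finset.sum_eq_single A]
  · simp
  · intro B _ hB
    simp [hB]
  · simp

theorem brickState_fa (j k : ℕ) (A : Fin 8) :
    brickState .fa j k A = (1 / 2 : ℂ) • (X A * (quadInv ^ j * cubicInv ^ k)) := by
  rw [brickState, FermionicBrick.bosons, pow_one, trace_generator_mul_brickMatrix, ← quadInv,
    ← cubicInv, smul_mul_assoc, smul_mul_assoc, mul_assoc]

theorem brickState_faa (j k : ℕ) (A : Fin 8) :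
    brickState .faa j k A = quadVec A * (quadInv ^ j * cubicInv ^ k) := by
  rw [brickState, FermionicBrick.bosons, ← quadVec, ← quadInv, ← cubicInv, mul_assoc]

theorem cubicInv_eq : cubicInv = ∑ A, X A * quadVec A := by
  have h : brickMatrix = ∑ A, (X A : BosonFock) • (generator A).map C := by
    ext1 i j
    simp [brickMatrix, Matrix.sum_apply, mul_comm]
  rw [cubicInv, pow_succ']
  nth_rewrite 1 [h]
  simp [Finset.sum_mul, Matrix.trace_sum, quadVec, Matrix.trace_smul]

/-- The scalars 1/2, i and 1/√3 are replaced by ring elements known through their algebraic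
relations, which reduces the component identities to polynomial algebra. -/
theorem brickMatrix_explicit : ∃ h i r : BosonFock, h = C (1 / 2) ∧ 2 * h = 1 ∧ i ^ 2 = -1 ∧
    r = C (1 / ((√3 : ℝ) : ℂ)) ∧ 3 * r ^ 2 = 1 ∧
    (generator 0).map C = !![0, h, 0; h, 0, 0; 0, 0, 0] ∧
    (generator 1).map C = !![0, -h * i, 0; h * i, 0, 0; 0, 0, 0] ∧
    (generator 2).map C = !![h, 0, 0; 0, -h, 0; 0, 0, 0] ∧
    (generator 3).map C = !![0, 0, h; 0, 0, 0; h, 0, 0] ∧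
    (generator 4).map C = !![0, 0, -h * i; 0, 0, 0; h * i, 0, 0] ∧
    (generator 5).map C = !![0, 0, 0; 0, 0, h; 0, h, 0] ∧
    (generator 6).map C = !![0, 0, 0; 0, 0, -h * i; 0, h * i, 0] ∧
    (generator 7).map C = !![h * r, 0, 0; 0, h * r, 0; 0, 0, -2 * h * r] ∧
    brickMatrix = !![h * X 2 + h * r * X 7, h * X 0 - h * i * X 1, h * X 3 - h * i * X 4;
      h * X 0 + h * i * X 1, -h * X 2 + h * r * X 7, h * X 5 - h * i * X 6;
      h * X 3 + h * i * X 4, h * X 5 + h * i * X 6, -2 * h * r * X 7] := by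
  have h3 : ((√3 : ℝ) : ℂ) ^ 2 = 3 := by
    rw [← Complex.ofReal_pow, Real.sq_sqrt (by norm_num)]; norm_num
  have h0 : ((√3 : ℝ) : ℂ) ≠ 0 := by
    intro h; rw [h] at h3; norm_num at h3
  have c2 : (2 : BosonFock) = C 2 := (map_ofNat C 2).symm
  have c3 : (3 : BosonFock) = C 3 := (map_ofNat C 3).symm
  have g7 : C (1 / ((2 * √3 : ℝ) : ℂ)) = C (1 / 2) * (C (1 / ((√3 : ℝ) : ℂ)) : BosonFock) := by
    rw [← C_mul]; congr 1; push_cast; field_simp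
  have e0 : (generator 0).map C = !![0, C (1 / 2), 0; C (1 / 2), 0, 0; 0, 0, (0 : BosonFock)] := by
    ext1 i j; fin_cases i <;> fin_cases j <;> simp [generator]
  have e1 : (generator 1).map C = !![0, -C (1 / 2) * C Complex.I, 0;
      C (1 / 2) * C Complex.I, 0, 0; 0, 0, (0 : BosonFock)] := by
    ext1 i j; fin_cases i <;> fin_cases j <;> simp [generator]
  have e2 : (generator 2).map C = !![C (1 / 2), 0, 0; 0, -C (1 / 2), 0; 0, 0, (0 : BosonFock)] := by
    ext1 i j; fin_cases i <;> fin_cases j <;> simp [generator]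
  have e3 : (generator 3).map C = !![0, 0, C (1 / 2); 0, 0, 0; C (1 / 2), 0, (0 : BosonFock)] := by
    ext1 i j; fin_cases i <;> fin_cases j <;> simp [generator]
  have e4 : (generator 4).map C = !![0, 0, -C (1 / 2) * C Complex.I; 0, 0, 0;
      C (1 / 2) * C Complex.I, 0, (0 : BosonFock)] := by
    ext1 i j; fin_cases i <;> fin_cases j <;> simp [generator]
  have e5 : (generator 5).map C = !![0, 0, 0; 0, 0, C (1 / 2); 0, C (1 / 2), (0 : BosonFock)] := by
    ext1 i j; fin_cases i <;> fin_cases j <;> simp [generator]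
  have e6 : (generator 6).map C = !![0, 0, 0; 0, 0, -C (1 / 2) * C Complex.I;
      0, C (1 / 2) * C Complex.I, (0 : BosonFock)] := by
    ext1 i j; fin_cases i <;> fin_cases j <;> simp [generator]
  have e7 : (generator 7).map C = !![C (1 / 2) * C (1 / ((√3 : ℝ) : ℂ)), 0, 0;
      0, C (1 / 2) * C (1 / ((√3 : ℝ) : ℂ)), 0;
      0, 0, -2 * C (1 / 2) * (C (1 / ((√3 : ℝ) : ℂ)) : BosonFock)] := by
    rw [show -2 * C (1 / 2) * (C (1 / ((√3 : ℝ) : ℂ)) : BosonFock) = C (1 / 2) *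
      (C (1 / ((√3 : ℝ) : ℂ)) : BosonFock) * C (-2) by rw [c2, C_neg]; ring, ← g7]
    ext1 i j; fin_cases i <;> fin_cases j <;> simp [generator]
    rw [mul_assoc, ← C_mul]; norm_num
  refine ⟨C (1 / 2), C Complex.I, C (1 / ((√3 : ℝ) : ℂ)), rfl, ?_, ?_, rfl, ?_,
    e0, e1, e2, e3, e4, e5, e6, e7, ?_⟩
  · rw [c2, ← C_mul]; norm_num
  · rw [← C_pow]; simp
  · rw [c3, ← C_pow, ← C_mul, one_div, inv_pow, h3]; norm_num
  · have h : brickMatrix = ∑ A, (X A : BosonFock) • (generator A).map C := by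
      ext1 i j
      simp [brickMatrix, Matrix.sum_apply, mul_comm]
    rw [h, Fin.sum_univ_eight, e0, e1, e2, e3, e4, e5, e6, e7]
    ext1 i j
    fin_cases i <;> fin_cases j <;> simp <;> ring

theorem quadVec_explicit : ∃ h r : BosonFock, h = C (1 / 2) ∧ r = C (1 / ((√3 : ℝ) : ℂ)) ∧ 2 * h = 1 ∧
    3 * r ^ 2 = 1 ∧ quadVec =
    ![h * h * (2 * r * X 0 * X 7 + X 3 * X 5 + X 4 * X 6),
      h * h * (2 * r * X 1 * X 7 - X 3 * X 6 + X 4 * X 5),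
      h * h * (2 * r * X 2 * X 7 + h * (X 3 ^ 2 + X 4 ^ 2 - X 5 ^ 2 - X 6 ^ 2)),
      h * h * (-r * X 3 * X 7 + X 0 * X 5 - X 1 * X 6 + X 2 * X 3),
      h * h * (-r * X 4 * X 7 + X 0 * X 6 + X 1 * X 5 + X 2 * X 4),
      h * h * (-r * X 5 * X 7 + X 0 * X 3 + X 1 * X 4 - X 2 * X 5),
      h * h * (-r * X 6 * X 7 + X 0 * X 4 - X 1 * X 3 - X 2 * X 6),
      h * h * (r * (X 0 ^ 2 + X 1 ^ 2 + X 2 ^ 2 - X 7 ^ 2)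
        - h * r * (X 3 ^ 2 + X 4 ^ 2 + X 5 ^ 2 + X 6 ^ 2))] := by
  obtain ⟨h, i, r, hC, hh, hi, hrC, hr, e0, e1, e2, e3, e4, e5, e6, e7, hM⟩ := brickMatrix_explicit
  refine ⟨h, r, hC, hrC, hh, hr, ?_⟩
  have key : ∀ A, quadVec A = ((generator A).map C * (brickMatrix * brickMatrix)).trace :=
    fun A => by rw [quadVec, pow_two]
  clear hC hrC
  ext1 A
  rw [key, hM]
  fin_cases A
  · simp only [Fin.zero_eta, e0, Matrix.trace_fin_three, Matrix.mul_apply, Fin.sum_univ_three]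
    simp; grind
  · simp only [Fin.mk_one, e1, Matrix.trace_fin_three, Matrix.mul_apply, Fin.sum_univ_three]
    simp; grind
  · simp only [Fin.reduceFinMk, e2, Matrix.trace_fin_three, Matrix.mul_apply, Fin.sum_univ_three]
    simp; grind
  · simp only [Fin.reduceFinMk, e3, Matrix.trace_fin_three, Matrix.mul_apply, Fin.sum_univ_three]
    simp; grind
  · simp only [Fin.reduceFinMk, e4, Matrix.trace_fin_three, Matrix.mul_apply, Fin.sum_univ_three]
    simp; grind
  · simp only [Fin.reduceFinMk, e5, Matrix.trace_fin_three, Matrix.mul_apply, Fin.sum_univ_three]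
    simp; grind
  · simp only [Fin.reduceFinMk, e6, Matrix.trace_fin_three, Matrix.mul_apply, Fin.sum_univ_three]
    simp; grind
  · simp only [Fin.reduceFinMk, e7, Matrix.trace_fin_three, Matrix.mul_apply, Fin.sum_univ_three]
    simp; grind

-- The table of derivatives is, up to a factor, the symmetric tensor d_ABC of SU(3) contracted with
-- X. The tensor identities below are read off from it.
set_option maxHeartbeats 1600000 in
theorem pderiv_quadVec_explicit : ∃ h r : BosonFock, (∀ B, pderiv B h = 0) ∧
    (∀ B, pderiv B r = 0) ∧ 2 * h = 1 ∧ 3 * r ^ 2 = 1 ∧ quadVec =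
    ![h * h * (2 * r * X 0 * X 7 + X 3 * X 5 + X 4 * X 6),
      h * h * (2 * r * X 1 * X 7 - X 3 * X 6 + X 4 * X 5),
      h * h * (2 * r * X 2 * X 7 + h * (X 3 ^ 2 + X 4 ^ 2 - X 5 ^ 2 - X 6 ^ 2)),
      h * h * (-r * X 3 * X 7 + X 0 * X 5 - X 1 * X 6 + X 2 * X 3),
      h * h * (-r * X 4 * X 7 + X 0 * X 6 + X 1 * X 5 + X 2 * X 4),
      h * h * (-r * X 5 * X 7 + X 0 * X 3 + X 1 * X 4 - X 2 * X 5),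
      h * h * (-r * X 6 * X 7 + X 0 * X 4 - X 1 * X 3 - X 2 * X 6),
      h * h * (r * (X 0 ^ 2 + X 1 ^ 2 + X 2 ^ 2 - X 7 ^ 2)
        - h * r * (X 3 ^ 2 + X 4 ^ 2 + X 5 ^ 2 + X 6 ^ 2))] ∧
    (fun A B => pderiv B (quadVec A)) =
    ![![h * r * X 7, 0, 0, h * h * X 5, h * h * X 6, h * h * X 3, h * h * X 4, h * r * X 0],
      ![0, h * r * X 7, 0, -h * h * X 6, h * h * X 5, h * h * X 4, -h * h * X 3, h * r * X 1],
      ![0, 0, h * r * X 7, h * h * X 3, h * h * X 4, -h * h * X 5, -h * h * X 6, h * r * X 2],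
      ![h * h * X 5, -h * h * X 6, h * h * X 3, h * h * (X 2 - r * X 7), 0, h * h * X 0,
        -h * h * X 1, -h * h * r * X 3],
      ![h * h * X 6, h * h * X 5, h * h * X 4, 0, h * h * (X 2 - r * X 7), h * h * X 1,
        h * h * X 0, -h * h * r * X 4],
      ![h * h * X 3, h * h * X 4, -h * h * X 5, h * h * X 0, h * h * X 1,
        h * h * (-X 2 - r * X 7), 0, -h * h * r * X 5],
      ![h * h * X 4, -h * h * X 3, -h * h * X 6, -h * h * X 1, h * h * X 0, 0,
        h * h * (-X 2 - r * X 7), -h * h * r * X 6],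
      ![h * r * X 0, h * r * X 1, h * r * X 2, -h * h * r * X 3, -h * h * r * X 4,
        -h * h * r * X 5, -h * h * r * X 6, -h * r * X 7]] := by
  obtain ⟨h, r, hC, hrC, hh, hr, hQ⟩ := quadVec_explicit
  have h1 : ∀ B, pderiv B h = 0 := fun B => by rw [hC, pderiv_C]
  have h2 : ∀ B, pderiv B r = 0 := fun B => by rw [hrC, pderiv_C]
  refine ⟨h, r, h1, h2, hh, hr, hQ, ?_⟩
  clear hC hrC
  ext1 A
  ext1 B
  rw [hQ]
  have h3 : ∀ B, pderiv B (2 : BosonFock) = 0 := fun B => by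
    exact_mod_cast (pderiv B : Derivation ℂ BosonFock BosonFock).map_natCast 2
  clear hQ
  fin_cases A <;> fin_cases B <;> simp [h1, h2, h3, pderiv_X] <;> grind only

/-- This is the symmetry of d_ABC; it makes `quadVec` one third of the gradient of `cubicInv`. -/
theorem quadVec_gradient_symm (A B : Fin 8) : pderiv B (quadVec A) = pderiv A (quadVec B) := by
  obtain ⟨h, r, h1, h2, hh, hr, hQ, hD⟩ := pderiv_quadVec_explicit
  have e : ∀ A B, pderiv B (quadVec A) = _ := fun A B => congrFun (congrFun hD A) B
  rw [e, e]
  fin_cases A <;> fin_cases B <;> simp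

/-- Tracelessness of d_ABC, as is the vanishing divergence below. -/
theorem laplace_quadVec (A : Fin 8) : ∑ B, pderiv B (pderiv B (quadVec A)) = 0 := by
  obtain ⟨h, r, h1, h2, hh, hr, hQ, hD⟩ := pderiv_quadVec_explicit
  have e : ∀ A B, pderiv B (quadVec A) = _ := fun A B => congrFun (congrFun hD A) B
  simp only [e]
  fin_cases A <;> (simp [Fin.sum_univ_eight, h1, h2, pderiv_X]; try grind only)

theorem divergence_quadVec : ∑ A, pderiv A (quadVec A) = 0 := by
  obtain ⟨h, r, h1, h2, hh, hr, hQ, hD⟩ := pderiv_quadVec_explicit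
  have e : ∀ A B, pderiv B (quadVec A) = _ := fun A B => congrFun (congrFun hD A) B
  simp only [e]
  simp [Fin.sum_univ_eight]
  grind

/-- This relation is special to 3×3 matrices: conceptually it is Cayley–Hamilton for a traceless
matrix a, a³ = (1/2) tr(a²) a + (1/3) tr(a³), traced against T^A after removing the trace part of
a². It lets a product of two `quadVec` contractions close on the two bricks. -/
theorem sum_pderiv_quadVec_mul_quadVec (A : Fin 8) :
    ∑ B, pderiv B (quadVec A) * quadVec B = (1 / 12 : ℂ) • (quadInv * X A) := by
  obtain ⟨h, r, h1, h2, hh, hr, hQ, hD⟩ := pderiv_quadVec_explicit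
  have e : ∀ A B, pderiv B (quadVec A) = _ := fun A B => congrFun (congrFun hD A) B
  have hu : (1 / 12 : ℂ) • (quadInv * X A) = (C (1 / 24) : BosonFock) *
      ((∑ B, X B * X B) * X A) := by
    rw [quadInv_eq, ← Finset.smul_sum, smul_mul_assoc, smul_smul, smul_eq_C_mul]
    norm_num
  have h24 : (24 : BosonFock) * C (1 / 24) = 1 := by
    rw [show (24 : BosonFock) = C 24 from (map_ofNat C 24).symm, ← C_mul]
    norm_num
  have hQ' : ∀ B, quadVec B = _ := fun B => congrFun hQ B
  rw [hu]
  generalize (C (1 / 24) : BosonFock) = c at h24 ⊢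
  simp only [e]
  simp only [hQ', Fin.sum_univ_eight]
  clear hQ hQ' e hD h1 h2 hu
  fin_cases A <;> simp <;> grind only

theorem quadVec_isHomogeneous (A : Fin 8) : (quadVec A).IsHomogeneous 2 := by
  have hM : ∀ i j, (brickMatrix i j).IsHomogeneous 1 := fun i j => by
    rw [brickMatrix, Matrix.of_apply]
    exact IsHomogeneous.sum _ _ _ fun A _ => (isHomogeneous_X ℂ A).C_mul _
  have hM2 : ∀ i j, ((brickMatrix ^ 2) i j).IsHomogeneous 2 := fun i j => by
    rw [pow_two, Matrix.mul_apply]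
    exact IsHomogeneous.sum _ _ _ fun k _ => (hM i k).mul (hM k j)
  rw [quadVec, Matrix.trace]
  refine IsHomogeneous.sum _ _ _ fun i _ => ?_
  rw [Matrix.diag, Matrix.mul_apply]
  refine IsHomogeneous.sum _ _ _ fun j _ => ?_
  exact (hM2 j i).C_mul _

theorem quadInv_isHomogeneous : quadInv.IsHomogeneous 2 := by
  rw [quadInv_eq]
  refine IsHomogeneous.sum _ _ _ fun A _ => ?_
  rw [smul_eq_C_mul]
  exact ((isHomogeneous_X ℂ A).mul (isHomogeneous_X ℂ A)).C_mul _

theorem cubicInv_isHomogeneous : cubicInv.IsHomogeneous 3 := by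
  rw [cubicInv_eq]
  exact IsHomogeneous.sum _ _ _ fun A _ => (isHomogeneous_X ℂ A).mul (quadVec_isHomogeneous A)

theorem brickState_isHomogeneous (b : FermionicBrick) (j k : ℕ) (A : Fin 8) :
    (brickState b j k A).IsHomogeneous (brickQuanta b j k) := by
  have hg := (quadInv_isHomogeneous.pow j).mul (cubicInv_isHomogeneous.pow k)
  cases b
  · rw [brickState_fa, smul_eq_C_mul]
    convert ((isHomogeneous_X ℂ A).mul hg).C_mul _ using 1
    simp [brickQuanta, FermionicBrick.bosons]; ring
  · rw [brickState_faa]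
    convert (quadVec_isHomogeneous A).mul hg using 1
    simp [brickQuanta, FermionicBrick.bosons]; ring

theorem pderiv_quadInv (A : Fin 8) : pderiv A quadInv = X A := by
  rw [quadInv_eq, map_sum, Finset.sum_eq_single A]
  · rw [Derivation.map_smul, Derivation.leibniz, pderiv_X_self, smul_eq_mul, mul_one, ← two_smul ℂ,
      smul_smul]
    norm_num
  · intro B _ hB
    rw [Derivation.map_smul, Derivation.leibniz, pderiv_X_of_ne hB]
    simp
  · simp

theorem sum_X_mul_pderiv_quadVec (A : Fin 8) : ∑ B, X B * pderiv B (quadVec A) = 2 * quadVec A := by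
  rw [(quadVec_isHomogeneous A).sum_X_mul_pderiv, nsmul_eq_mul]
  rfl

theorem pderiv_cubicInv (A : Fin 8) : pderiv A cubicInv = 3 * quadVec A := by
  rw [cubicInv_eq, map_sum]
  simp only [Derivation.leibniz, smul_eq_mul, Finset.sum_add_distrib, quadVec_gradient_symm _ A]
  rw [sum_X_mul_pderiv_quadVec, Finset.sum_eq_single A]
  · simp; ring
  · intro B _ hB
    rw [pderiv_X_of_ne hB, mul_zero]
  · simp

/-- Euler's identity writes one factor as X contracted with its derivatives; the symmetry of these
derivatives then reduces the sum to the previous contraction. -/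
theorem sum_quadVec_mul_quadVec :
    ∑ A, quadVec A * quadVec A = (1 / 12 : ℂ) • (quadInv ^ 2) := by
  have h1 : ∀ A, quadVec A = (1 / 2 : ℂ) • ∑ B, X B * pderiv B (quadVec A) := fun A => by
    rw [sum_X_mul_pderiv_quadVec, show (2 : BosonFock) = C 2 from (map_ofNat C 2).symm,
      ← smul_eq_C_mul, smul_smul]
    norm_num
  calc _ = ∑ A, (1 / 2 : ℂ) • ∑ B, X B * (pderiv A (quadVec B) * quadVec A) := by
        refine Finset.sum_congr rfl fun A _ => ?_
        nth_rewrite 1 [h1 A]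
        rw [smul_mul_assoc, Finset.sum_mul]
        simp only [quadVec_gradient_symm A, mul_assoc]
    _ = (1 / 2 : ℂ) • ∑ B, X B * ∑ A, pderiv A (quadVec B) * quadVec A := by
        rw [← Finset.smul_sum, Finset.sum_comm]
        simp only [Finset.mul_sum]
    _ = _ := by
        simp only [sum_pderiv_quadVec_mul_quadVec]
        have h2 : quadInv = (1 / 2 : ℂ) • ∑ B, (X B * X B : BosonFock) := by
          rw [quadInv_eq, Finset.smul_sum]
        have h3 : ∀ B : Fin 8, (X B * (1 / 12 : ℂ) • (quadInv * X B) : BosonFock) =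
            (1 / 12 : ℂ) • (quadInv * (X B * X B)) := fun B => by
          rw [mul_smul_comm]; congr 1; ring
        simp only [h3]
        rw [← Finset.smul_sum, ← Finset.mul_sum, smul_comm, ← mul_smul_comm, ← h2, pow_two]

/-! ### The Laplacian of invariants and brick states -/

theorem pderiv_invariants (j k : ℕ) (A : Fin 8) :
    pderiv A (quadInv ^ j * cubicInv ^ k) =
      (j : BosonFock) * (quadInv ^ (j - 1) * cubicInv ^ k) * X A
        + 3 * (k : BosonFock) * (quadInv ^ j * cubicInv ^ (k - 1)) * quadVec A := by
  rw [Derivation.leibniz, Derivation.leibniz_pow, Derivation.leibniz_pow, pderiv_quadInv,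
    pderiv_cubicInv]
  simp only [smul_eq_mul, nsmul_eq_mul]
  ring

theorem sum_X_mul_pderiv_invariants (j k : ℕ) :
    ∑ A, X A * pderiv A (quadInv ^ j * cubicInv ^ k) =
      ((2 * j + 3 * k : ℕ) : BosonFock) * (quadInv ^ j * cubicInv ^ k) := by
  rw [((quadInv_isHomogeneous.pow j).mul (cubicInv_isHomogeneous.pow k)).sum_X_mul_pderiv,
    nsmul_eq_mul]

theorem sum_quadVec_mul_pderiv_invariants (j k : ℕ) :
    ∑ A, quadVec A * pderiv A (quadInv ^ j * cubicInv ^ k) =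
      (j : BosonFock) * (quadInv ^ (j - 1) * cubicInv ^ k) * cubicInv
        + (1 / 4 : ℂ) • ((k : BosonFock) * (quadInv ^ j * cubicInv ^ (k - 1)) * quadInv ^ 2) := by
  have h : ∀ A, quadVec A * pderiv A (quadInv ^ j * cubicInv ^ k) =
      (j : BosonFock) * (quadInv ^ (j - 1) * cubicInv ^ k) * (X A * quadVec A)
        + 3 * (k : BosonFock) * (quadInv ^ j * cubicInv ^ (k - 1)) * (quadVec A * quadVec A) := fun A => by
    rw [pderiv_invariants]; ring
  simp only [h]
  rw [Finset.sum_add_distrib, ← Finset.mul_sum, ← Finset.mul_sum, ← cubicInv_eq,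
    sum_quadVec_mul_quadVec, mul_smul_comm]
  congr 1
  rw [show (3 : BosonFock) = C 3 from (map_ofNat C 3).symm, mul_assoc (C 3), mul_assoc (C 3),
    ← smul_eq_C_mul, smul_smul]
  norm_num

/-- The Laplacian of a product of invariants. -/
theorem laplace_invariants (j k : ℕ) :
    ∑ A, pderiv A (pderiv A (quadInv ^ j * cubicInv ^ k)) =
      (2 * j * (j + 3 * k + 3) : ℂ) • (quadInv ^ (j - 1) * cubicInv ^ k)
        + (3 / 4 * k * (k - 1) : ℂ) • (quadInv ^ (j + 2) * cubicInv ^ (k - 2)) := by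
  have h : ∀ A, pderiv A (pderiv A (quadInv ^ j * cubicInv ^ k)) =
      (j : BosonFock) * (quadInv ^ (j - 1) * cubicInv ^ k)
      + (j : BosonFock) * (X A * pderiv A (quadInv ^ (j - 1) * cubicInv ^ k))
      + 3 * (k : BosonFock) * (quadInv ^ j * cubicInv ^ (k - 1)) * pderiv A (quadVec A)
      + 3 * (k : BosonFock) * (quadVec A * pderiv A (quadInv ^ j * cubicInv ^ (k - 1))) := fun A => by
    rw [pderiv_invariants]
    have h1 : pderiv A (j : BosonFock) = 0 := (pderiv A).map_natCast j
    have h2 : pderiv A (3 * k : BosonFock) = 0 := by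
      exact_mod_cast (pderiv A : Derivation ℂ BosonFock BosonFock).map_natCast (3 * k)
    rw [map_add, Derivation.leibniz, Derivation.leibniz (pderiv A) (j : BosonFock),
      Derivation.leibniz (pderiv A) (3 * (k : BosonFock) * _) (quadVec A),
      Derivation.leibniz (pderiv A) (3 * (k : BosonFock)), h1, h2, pderiv_X_self]
    simp only [smul_eq_mul]
    ring
  simp only [h]
  rw [Finset.sum_add_distrib, Finset.sum_add_distrib, Finset.sum_add_distrib, Finset.sum_const,
    ← Finset.mul_sum,
    ← Finset.mul_sum, ← Finset.mul_sum, divergence_quadVec, sum_X_mul_pderiv_invariants,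
    sum_quadVec_mul_pderiv_invariants]
  simp only [Finset.card_univ, Fintype.card_fin, smul_eq_C_mul, nsmul_eq_mul]
  have h34 : (C (3 / 4) : BosonFock) = 3 * C (1 / 4) := by
    rw [show (3 : BosonFock) = C 3 from (map_ofNat C 3).symm, ← C_mul]; norm_num
  have hn : ∀ n : ℕ, (C (n : ℂ) : BosonFock) = n := fun n => map_natCast C n
  simp only [C_mul, C_add, C_sub, hn, h34, map_ofNat, C_1]
  -- Exponents such as j - 1 and k - 2 are truncated; in the small cases the coefficient in front of
  -- them vanishes.
  rcases j with _ | j <;> rcases k with _ | _ | k <;>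
    simp only [Nat.cast_add, Nat.cast_mul, Nat.cast_one, Nat.cast_zero, Nat.cast_ofNat,
      pow_succ, pow_zero, Nat.add_one_sub_one, Nat.reduceSubDiff,
      zero_add, Nat.sub_self] <;>
    ring

theorem laplace_mul (f g : BosonFock) :
    ∑ B, pderiv B (pderiv B (f * g)) = f * ∑ B, pderiv B (pderiv B g)
      + 2 * ∑ B, pderiv B f * pderiv B g + g * ∑ B, pderiv B (pderiv B f) := by
  simp only [Finset.mul_sum, ← Finset.sum_add_distrib]
  refine Finset.sum_congr rfl fun B _ => ?_
  simp only [Derivation.leibniz, map_add, smul_eq_mul]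
  ring

/-- Since X_A is linear, the cross term of the product rule is the A-th derivative of the
invariants. Its `quadVec` part turns the brick into `faa`. -/
theorem laplace_brickState_fa (j k : ℕ) (A : Fin 8) :
    ∑ B, pderiv B (pderiv B (brickState .fa j k A)) =
      (2 * j * (j + 3 * k + 4) : ℂ) • brickState .fa (j - 1) k A
      + (3 * k : ℂ) • brickState .faa j (k - 1) A
      + (3 / 4 * k * (k - 1) : ℂ) • brickState .fa (j + 2) (k - 2) A := by
  simp only [brickState_fa, brickState_faa, Derivation.map_smul, ← Finset.smul_sum]
  rw [laplace_mul, laplace_invariants]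
  have h1 : ∑ B, pderiv B (X A : BosonFock) * pderiv B (quadInv ^ j * cubicInv ^ k) =
      pderiv A (quadInv ^ j * cubicInv ^ k) := by
    rw [Finset.sum_eq_single A]
    · simp
    · intro B _ hB
      rw [pderiv_X_of_ne hB.symm, zero_mul]
    · simp
  have h2 : ∑ B, pderiv B (pderiv B (X A : BosonFock)) = 0 := by
    refine Finset.sum_eq_zero fun B _ => ?_
    rw [pderiv_X, Pi.single_apply]
    split_ifs <;> simp
  have hn : ∀ n : ℕ, (C (n : ℂ) : BosonFock) = n := fun n => map_natCast C n
  have hh : (2 : BosonFock) * C (1 / 2) = 1 := by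
    rw [show (2 : BosonFock) = C 2 from (map_ofNat C 2).symm, ← C_mul]; norm_num
  rw [h1, h2, pderiv_invariants]
  simp only [smul_eq_C_mul, C_mul, C_add, C_sub, hn, map_ofNat, C_1]
  linear_combination (3 * k * (quadInv ^ j * cubicInv ^ (k - 1)) * quadVec A) * hh

/-- In the cross term, the X part is Euler's identity for `quadVec A`, and the `quadVec` part is the
Cayley–Hamilton contraction. The latter turns the brick into `fa` and supplies an extra quadratic
brick. -/
theorem laplace_brickState_faa (j k : ℕ) (A : Fin 8) :
    ∑ B, pderiv B (pderiv B (brickState .faa j k A)) =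
      (2 * j * (j + 3 * k + 5) : ℂ) • brickState .faa (j - 1) k A
      + (k : ℂ) • brickState .fa (j + 1) (k - 1) A
      + (3 / 4 * k * (k - 1) : ℂ) • brickState .faa (j + 2) (k - 2) A := by
  simp only [brickState_fa, brickState_faa]
  rw [laplace_mul, laplace_invariants, laplace_quadVec]
  have h1 : ∑ B, pderiv B (quadVec A) * pderiv B (quadInv ^ j * cubicInv ^ k) =
      (j : BosonFock) * (quadInv ^ (j - 1) * cubicInv ^ k) * (2 * quadVec A)
      + 3 * (k : BosonFock) * (quadInv ^ j * cubicInv ^ (k - 1)) * (C (1 / 12) * (quadInv * X A)) := by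
    rw [← smul_eq_C_mul, ← sum_pderiv_quadVec_mul_quadVec, ← sum_X_mul_pderiv_quadVec,
      Finset.mul_sum, Finset.mul_sum, ← Finset.sum_add_distrib]
    refine Finset.sum_congr rfl fun B _ => ?_
    rw [pderiv_invariants]
    ring
  have hn : ∀ n : ℕ, (C (n : ℂ) : BosonFock) = n := fun n => map_natCast C n
  have h12 : (6 : BosonFock) * C (1 / 12) = C (1 / 2) := by
    rw [show (6 : BosonFock) = C 6 from (map_ofNat C 6).symm, ← C_mul]; norm_num
  rw [h1]
  simp only [smul_eq_C_mul, C_mul, C_add, C_sub, hn, map_ofNat, C_1]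
  linear_combination (k * (quadInv ^ (j + 1) * cubicInv ^ (k - 1)) * X A) * h12

/-! ### The Hamiltonian as a differential operator, and the cut-off -/

theorem hamiltonian_apply (ψ : OneFermionFock) (A : Fin 8) :
    hamiltonian ψ A = (1 / 2 : ℂ) • ∑ B, X B * pderiv B (ψ A) + (2 : ℂ) • ψ A
      - (1 / 2 : ℂ) • (quadInv * ψ A) - (1 / 4 : ℂ) • ∑ B, pderiv B (pderiv B (ψ A)) := by
  have h1 : (creationMatrix * annihilationMatrix).trace =
      ∑ A, (1 / 2 : ℂ) • (creationOp A * annihilationOp A) := trace_generator_sum_mul _ _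
  have h2 : (creationMatrix * creationMatrix).trace =
      ∑ A, (1 / 2 : ℂ) • (creationOp A * creationOp A) := trace_generator_sum_mul _ _
  have h3 : (annihilationMatrix * annihilationMatrix).trace =
      ∑ A, (1 / 2 : ℂ) • (annihilationOp A * annihilationOp A) := trace_generator_sum_mul _ _
  have hu : quadInv * ψ A = (1 / 2 : ℂ) • ∑ B, X B * (X B * ψ A) := by
    rw [quadInv_eq, ← Finset.smul_sum, smul_mul_assoc, Finset.sum_mul]
    simp only [mul_assoc]
  rw [hamiltonian, h1, h2, h3, hu]
  simp only [LinearMap.sub_apply, LinearMap.add_apply, LinearMap.smul_apply, ← Finset.smul_sum,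
    LinearMap.sum_apply, Pi.sub_apply, Pi.add_apply, Pi.smul_apply, Finset.sum_apply,
    Module.End.mul_apply, Module.End.one_apply, smul_smul]
  norm_num
  rfl

theorem quantaCutoff_brickState (N : ℕ) (b : FermionicBrick) (j k : ℕ) :
    quantaCutoff N (brickState b j k) =
      if brickQuanta b j k ≤ N then brickState b j k else 0 := by
  ext1 A
  have h : quantaCutoff N (brickState b j k) A =
      ∑ i ∈ Finset.range (N + 1), homogeneousComponent i (brickState b j k A) := by
    simp [quantaCutoff, LinearMap.compLeft]
  rw [h, Finset.sum_congr rfl fun i _ =>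
    homogeneousComponent_of_mem (brickState_isHomogeneous b j k A), Finset.sum_ite_eq']
  simp only [Finset.mem_range, Nat.lt_succ_iff]
  split_ifs <;> rfl

/-! ### Linear independence of the brick states -/

/-- The coordinates of the companion matrix `!![0, 1, 0; 0, 0, 1; X 1, X 0, 0]`, on which
`(a†a†)` and `(a†a†a†)` take the values `2 * X 0` and `3 * X 1`. -/
noncomputable def companionPoint : Fin 8 → MvPolynomial (Fin 2) ℂ :=
  ![1, C Complex.I, 0, X 1, -C Complex.I * X 1, 1 + X 0, C Complex.I * (1 - X 0), 0]

/-- For the companion matrix M, the combinations T^0 - iT^1 and T^3 - iT^4 (indices from 0) are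
matrix units that read off the (1,2) and (1,3) entries. These entries are 1, 0 for M and 0, 1 for
M², which separates the two fermionic bricks. -/
theorem companion_eval :
    aeval companionPoint quadInv = (2 * X 0 : MvPolynomial (Fin 2) ℂ) ∧
    aeval companionPoint cubicInv = (3 * X 1 : MvPolynomial (Fin 2) ℂ) ∧
    aeval companionPoint (quadVec 0) - C Complex.I * aeval companionPoint (quadVec 1) = 0 ∧
    aeval companionPoint (quadVec 3) - C Complex.I * aeval companionPoint (quadVec 4) = 1 := by
  obtain ⟨h, r, hC, hrC, hh, hr, hQ⟩ := quadVec_explicit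
  have hh' : 2 * aeval companionPoint h = 1 := by
    rw [show (2 : MvPolynomial (Fin 2) ℂ) = aeval companionPoint (2 : BosonFock) from
      (map_ofNat _ 2).symm, ← map_mul, hh, map_one]
  have hi : (C Complex.I : MvPolynomial (Fin 2) ℂ) ^ 2 = -1 := by
    rw [← C_pow]; simp
  have hu : quadInv = h * ∑ A, X A * X A := by
    rw [quadInv_eq, hC, ← smul_eq_C_mul, Finset.smul_sum]
  have hQ' : ∀ B, quadVec B = _ := fun B => congrFun hQ B
  rw [hu, cubicInv_eq]
  simp only [hQ', Fin.sum_univ_eight]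
  clear hQ hQ' hC hrC hh hu
  simp only [map_mul, map_add, map_sub, map_neg, map_pow, map_ofNat, aeval_X, Matrix.cons_val]
  generalize aeval companionPoint h = e at *
  generalize aeval companionPoint r = r' at *
  simp only [companionPoint, Matrix.cons_val]
  generalize (C Complex.I : MvPolynomial (Fin 2) ℂ) = i at *
  refine ⟨?_, ?_, ?_, ?_⟩ <;> grind only

/-- The functional which extracts the brick `b`. -/
noncomputable def brickFunctional (b : FermionicBrick) :
    OneFermionFock →ₗ[ℂ] MvPolynomial (Fin 2) ℂ :=
  match b with
  | .fa => (aeval companionPoint).toLinearMap ∘ₗ LinearMap.proj 0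
      - Complex.I • (aeval companionPoint).toLinearMap ∘ₗ LinearMap.proj 1
  | .faa => (aeval companionPoint).toLinearMap ∘ₗ LinearMap.proj 3
      - Complex.I • (aeval companionPoint).toLinearMap ∘ₗ LinearMap.proj 4

open scoped Classical in
theorem brickFunctional_brickState (b b' : FermionicBrick) (j k : ℕ) :
    brickFunctional b (brickState b' j k) =
      if b' = b then monomial (Finsupp.single 0 j + Finsupp.single 1 k) (2 ^ j * 3 ^ k) else 0 := by
  obtain ⟨h1, h2, h3, h4⟩ := companion_eval
  have hg : (2 * X 0) ^ j * (3 * X 1) ^ k = (monomial (Finsupp.single 0 j + Finsupp.single 1 k)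
      (2 ^ j * 3 ^ k) : MvPolynomial (Fin 2) ℂ) := by
    rw [monomial_eq, Finsupp.prod_add_index' (by simp) (by simp [pow_add])]
    simp only [pow_zero, Finsupp.prod_single_index, mul_pow, C_mul, C_pow, map_ofNat]
    ring
  have hi : (C Complex.I : MvPolynomial (Fin 2) ℂ) ^ 2 = -1 := by
    rw [← C_pow]; simp
  have hh : (2 : MvPolynomial (Fin 2) ℂ) * C (1 / 2) = 1 := by
    rw [show (2 : MvPolynomial (Fin 2) ℂ) = C 2 from (map_ofNat C 2).symm, ← C_mul]; norm_num
  rw [← hg]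
  cases b <;> cases b' <;>
    simp only [brickFunctional, LinearMap.sub_apply, LinearMap.smul_apply, LinearMap.comp_apply,
      LinearMap.proj_apply, AlgHom.toLinearMap_apply, brickState_fa, brickState_faa, aeval_C, algebraMap_eq,
      map_mul, map_pow, aeval_X, h1, h2, smul_eq_C_mul, reduceCtorEq, if_true, if_false]
  · simp only [companionPoint, Matrix.cons_val_zero, Matrix.cons_val_one]
    linear_combination (-C (1 / 2) * ((2 * X 0) ^ j * (3 * X 1) ^ k)) * hi
      + ((2 * X 0) ^ j * (3 * X 1) ^ k) * hh
  · linear_combination ((2 * X 0) ^ j * (3 * X 1) ^ k) * h3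
  · simp only [companionPoint, Matrix.cons_val]
    linear_combination (C (1 / 2) * X 1 * ((2 * X 0) ^ j * (3 * X 1) ^ k)) * hi
  · linear_combination ((2 * X 0) ^ j * (3 * X 1) ^ k) * h4

/-- On companion matrices the traces become multiples of two independent variables, so the
functional of a brick sends distinct states with that brick to distinct monomials and annihilates
those with the other. -/
theorem brickState_linearIndependent :
    LinearIndependent ℂ (fun s : FermionicBrick × ℕ × ℕ => brickState s.1 s.2.1 s.2.2) := by
  classical
  rw [linearIndependent_iff']
  rintro S g hg ⟨b, j, k⟩ hs
  have h := congrArg (fun ψ => coeff (Finsupp.single 0 j + Finsupp.single 1 k)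
    (brickFunctional b ψ)) hg
  simp only [map_sum, map_smul, map_zero, coeff_zero, coeff_sum, coeff_smul] at h
  rw [Finset.sum_eq_single (b, j, k)] at h
  · simpa [brickFunctional_brickState] using h
  · rintro ⟨b', j', k'⟩ _ hne
    rw [brickFunctional_brickState]
    dsimp only
    split_ifs with hb
    · subst hb
      rw [coeff_monomial, if_neg, smul_zero]
      intro heq
      apply hne
      have e0 := DFunLike.congr_fun heq 0
      have e1 := DFunLike.congr_fun heq 1
      simp at e0 e1
      rw [e0, e1]
    · simp
  · exact fun h' => absurd hs h'

/-! ### Creation and Laplacian as operators on the one-fermion sector -/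

/-- The Laplacian on the one-fermion sector. -/
noncomputable def laplacian : Module.End ℂ OneFermionFock :=
  ∑ B, annihilationOp B * annihilationOp B

theorem laplacian_apply (ψ : OneFermionFock) (A : Fin 8) :
    laplacian ψ A = ∑ B, pderiv B (pderiv B (ψ A)) := by
  simp only [laplacian, LinearMap.sum_apply, Finset.sum_apply]
  rfl

/-- Creation of one more quadratic brick. -/
noncomputable def quadCreation : Module.End ℂ OneFermionFock :=
  (LinearMap.mulLeft ℂ quadInv).compLeft (Fin 8)

theorem quadCreation_brickState (b : FermionicBrick) (j k : ℕ) :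
    quadCreation (brickState b j k) = brickState b (j + 1) k := by
  ext1 A
  change quadInv * brickState b j k A = _
  cases b
  · rw [brickState_fa, brickState_fa, mul_smul_comm]; ring_nf
  · rw [brickState_faa, brickState_faa]; ring

theorem hamiltonian_of_homogeneous (ψ : OneFermionFock) (q : ℕ)
    (hψ : ∀ A, (ψ A).IsHomogeneous q) :
    hamiltonian ψ = ((q : ℂ) / 2 + 2) • ψ - (1 / 2 : ℂ) • quadCreation ψ
      - (1 / 4 : ℂ) • laplacian ψ := by
  ext1 A
  rw [hamiltonian_apply, (hψ A).sum_X_mul_pderiv]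
  simp only [Pi.sub_apply, Pi.smul_apply, laplacian_apply]
  rw [add_smul, ← Nat.cast_smul_eq_nsmul ℂ, smul_smul,
    show (q : ℂ) / 2 = 1 / 2 * q by ring]
  rfl

theorem laplacian_brickState_fa (j k : ℕ) : laplacian (brickState .fa j k) =
      (2 * j * (j + 3 * k + 4) : ℂ) • brickState .fa (j - 1) k
      + (3 * k : ℂ) • brickState .faa j (k - 1)
      + (3 / 4 * k * (k - 1) : ℂ) • brickState .fa (j + 2) (k - 2) := by
  ext1 A
  rw [laplacian_apply, laplace_brickState_fa]
  rfl

theorem laplacian_brickState_faa (j k : ℕ) : laplacian (brickState .faa j k) =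
      (2 * j * (j + 3 * k + 5) : ℂ) • brickState .faa (j - 1) k
      + (k : ℂ) • brickState .fa (j + 1) (k - 1)
      + (3 / 4 * k * (k - 1) : ℂ) • brickState .faa (j + 2) (k - 2) := by
  ext1 A
  rw [laplacian_apply, laplace_brickState_faa]
  rfl

end Bricks

/-! ### Chains of fixed parity and the diagonalising combinations -/

theorem chainBrick_alternates (P : QuantaParity) (t : ℕ) :
    (chainBrick P t = .fa ∧ chainBrick P (t + 1) = .faa) ∨
      (chainBrick P t = .faa ∧ chainBrick P (t + 1) = .fa) := by
  cases P <;> by_cases h : Even t <;> simp [chainBrick, h, Nat.even_add_one]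

theorem chainBrick_add_two (P : QuantaParity) (t : ℕ) :
    chainBrick P (t + 2) = chainBrick P t := by
  cases P <;> simp [chainBrick, Nat.even_add]

theorem chainIndex_add_two (P : QuantaParity) (t : ℕ) :
    chainIndex P (t + 2) = chainIndex P t + 6 := by
  simp only [chainIndex, chainBrick_add_two]
  ring

/-- One more cubic brick adds 3 to the index, and the swap of the fermionic brick adds or subtracts
1. Each step is therefore 4 or 2: index differences are even and positive, which makes the shift
integral and the denominators of Γ nonzero. -/
theorem exists_chainIndex_eq (P : QuantaParity) {m y : ℕ} (h : y ≤ m) :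
    ∃ s, chainIndex P m = chainIndex P y + 2 * s ∧ m - y ≤ s := by
  induction m, h using Nat.le_induction with
  | base => exact ⟨0, by simp⟩
  | succ m hm ih =>
    obtain ⟨s, hs, hle⟩ := ih
    rcases chainBrick_alternates P m with ⟨h1, h2⟩ | ⟨h1, h2⟩
    · refine ⟨s + 2, ?_, by omega⟩
      simp only [chainIndex, h1, h2, FermionicBrick.bosons] at hs ⊢
      omega
    · refine ⟨s + 1, ?_, by omega⟩
      simp only [chainIndex, h1, h2, FermionicBrick.bosons] at hs ⊢
      omega

/-- The basis state with `y` cubic and `j` quadratic bricks of parity `P`. -/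
noncomputable def chainBasis (P : QuantaParity) (y j : ℕ) : OneFermionFock :=
  brickState (chainBrick P y) j y

/-- The excess of quadratic bricks that compensates `m - y` missing cubic bricks. -/
def chainShift (P : QuantaParity) (m y : ℕ) : ℕ := (chainIndex P m - chainIndex P y) / 2

theorem chainIndex_eq (P : QuantaParity) {m y : ℕ} (h : y ≤ m) :
    chainIndex P m = chainIndex P y + 2 * chainShift P m y := by
  obtain ⟨s, hs, -⟩ := exists_chainIndex_eq P h
  simp only [chainShift]
  omega

theorem chainIndex_lt (P : QuantaParity) {m y : ℕ} (h : y < m) :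
    chainIndex P y < chainIndex P m := by
  obtain ⟨s, hs, h'⟩ := exists_chainIndex_eq P h.le
  omega

theorem chainShift_self (P : QuantaParity) (m : ℕ) : chainShift P m m = 0 := by
  simp [chainShift]

/-- The part of the Laplacian that removes one cubic brick. -/
noncomputable def removeOneCubic (P : QuantaParity) : ℕ → ℕ → OneFermionFock
  | 0, _ => 0
  | y + 1, j => (-2 * chainChi P y : ℂ) • chainBasis P y (j + chainShift P (y + 1) y - 1)

/-- The part of the Laplacian that removes two cubic bricks. -/
noncomputable def removeTwoCubic (P : QuantaParity) : ℕ → ℕ → OneFermionFock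
  | 0, _ => 0
  | 1, _ => 0
  | y + 2, j => (-2 * chainMu y : ℂ) • chainBasis P y (j + 2)

theorem laplacian_chainBasis (P : QuantaParity) (y j : ℕ) :
    laplacian (chainBasis P y j) =
      (2 * j * (j + chainIndex P y) : ℂ) • chainBasis P y (j - 1)
        + removeOneCubic P y j + removeTwoCubic P y j := by
  have h2 : ∀ b, chainBrick P y = b → (3 / 4 * y * (y - 1) : ℂ) • brickState b (j + 2) (y - 2) =
      removeTwoCubic P y j := by
    rintro b rfl
    rcases y with _ | _ | y
    · simp [removeTwoCubic]
    · simp [removeTwoCubic]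
    · simp only [removeTwoCubic, chainBasis, chainBrick_add_two, chainMu]
      congr 1
      push_cast
      ring
  rcases hb : chainBrick P y with _ | _
  · rw [← h2 _ hb, chainBasis, chainBasis, hb, laplacian_brickState_fa]
    congr 2
    · congr 1
      simp only [chainIndex, hb, FermionicBrick.bosons]
      push_cast
      ring
    · rcases y with _ | y
      · simp [removeOneCubic]
      · rcases chainBrick_alternates P y with ⟨h3, h4⟩ | ⟨h3, h4⟩
        · rw [h4] at hb
          cases hb
        · simp only [removeOneCubic, chainBasis, h3, chainChi, chainShift, chainIndex, h4,
            FermionicBrick.bosons, Nat.add_sub_cancel]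
          -- The shift across one step is 1 here and 2 in the opposite case below, so subtracting 1
          -- gives j and j + 1 respectively.
          rw [show j + (3 * (y + 1) + 3 + 1 - (3 * y + 3 + 2)) / 2 - 1 = j by omega]
          congr 1
          push_cast
          ring
  · rw [← h2 _ hb, chainBasis, chainBasis, hb, laplacian_brickState_faa]
    congr 2
    · congr 1
      simp only [chainIndex, hb, FermionicBrick.bosons]
      push_cast
      ring
    · rcases y with _ | y
      · simp [removeOneCubic]
      · rcases chainBrick_alternates P y with ⟨h3, h4⟩ | ⟨h3, h4⟩
        · simp only [removeOneCubic, chainBasis, h3, chainChi, chainShift, chainIndex, h4,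
            FermionicBrick.bosons, Nat.add_sub_cancel]
          rw [show j + (3 * (y + 1) + 3 + 2 - (3 * y + 3 + 1)) / 2 - 1 = j + 1 by omega]
          congr 1
          push_cast
          ring
        · rw [h4] at hb
          cases hb

theorem mixing_self (P : QuantaParity) (m : ℕ) : mixing P m m = 1 := by
  rw [mixing]; simp

theorem mixing_of_lt (P : QuantaParity) {m y : ℕ} (h : m < y) : mixing P m y = 0 := by
  rw [mixing]; simp [h]

/-- Cleared of the denominator, the recursion also holds at y = m, where both sides vanish. -/
theorem mixing_recurrence (P : QuantaParity) {m y : ℕ} (h : y ≤ m) :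
    mixing P m y * ((chainIndex P m : ℝ) ^ 2 - (chainIndex P y : ℝ) ^ 2) =
      4 * (chainChi P y * mixing P m (y + 1) + chainMu y * mixing P m (y + 2)) := by
  rcases h.eq_or_lt with rfl | h
  · rw [mixing_of_lt P (by omega : y < y + 1), mixing_of_lt P (by omega : y < y + 2)]
    ring
  · rw [mixing, if_neg (by omega), if_neg (by omega), div_mul_cancel₀]
    have h1 : (chainIndex P y : ℝ) < chainIndex P m := by exact_mod_cast chainIndex_lt P h
    have h2 : (0 : ℝ) ≤ chainIndex P y := by positivity
    nlinarith

/-- The combination of basis states which the Laplacian maps to a multiple of the next lower one. -/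
noncomputable def chainState (P : QuantaParity) (m n : ℕ) : OneFermionFock :=
  ∑ y ∈ Finset.range (m + 1), (mixing P m y : ℂ) • chainBasis P y (n + chainShift P m y)

theorem chainShift_add_one (P : QuantaParity) {m y : ℕ} (h : y + 1 ≤ m) :
    chainShift P m y = chainShift P m (y + 1) + chainShift P (y + 1) y := by
  have h1 := chainIndex_eq P (by omega : y ≤ m)
  have h2 := chainIndex_eq P h
  have h3 := chainIndex_eq P (by omega : y ≤ y + 1)
  omega

theorem chainShift_add_two (P : QuantaParity) {m y : ℕ} (h : y + 2 ≤ m) :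
    chainShift P m y = chainShift P m (y + 2) + 3 := by
  have h1 := chainIndex_eq P (by omega : y ≤ m)
  have h2 := chainIndex_eq P h
  have h3 := chainIndex_add_two P y
  omega

theorem laplacian_chainState (P : QuantaParity) (m n : ℕ) :
    laplacian (chainState P m n) =
      (2 * n * (n + chainIndex P m) : ℂ) • chainState P m (n - 1) := by
  set G : ℕ → OneFermionFock := fun y => chainBasis P y (n + chainShift P m y - 1) with hG
  have e1 : ∑ y ∈ Finset.range (m + 1), (mixing P m y : ℂ) •
        removeOneCubic P y (n + chainShift P m y) =
      ∑ y ∈ Finset.range (m + 1), (-2 * chainChi P y * mixing P m (y + 1) : ℂ) • G y := by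
    -- Shifting the index costs no boundary term: nothing can be removed at y = 0, and Γ vanishes at
    -- m + 1.
    rw [Finset.sum_range_succ', Finset.sum_range_succ, mixing_of_lt P (Nat.lt_succ_self m)]
    simp only [removeOneCubic, smul_zero, add_zero, Complex.ofReal_zero, mul_zero, zero_smul]
    refine Finset.sum_congr rfl fun y hy => ?_
    rw [Finset.mem_range] at hy
    rw [smul_smul, hG]
    dsimp only
    rw [chainShift_add_one P (by omega : y + 1 ≤ m), ← add_assoc, mul_comm]
  have e2 : ∑ y ∈ Finset.range (m + 1), (mixing P m y : ℂ) •
        removeTwoCubic P y (n + chainShift P m y) =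
      ∑ y ∈ Finset.range (m + 1), (-2 * chainMu y * mixing P m (y + 2) : ℂ) • G y := by
    rcases m with _ | m
    · simp [removeTwoCubic, mixing_of_lt]
    rw [Finset.sum_range_succ', Finset.sum_range_succ', Finset.sum_range_succ,
      Finset.sum_range_succ, mixing_of_lt P (by omega : m + 1 < m + 2),
      mixing_of_lt P (by omega : m + 1 < m + 1 + 2)]
    simp only [removeTwoCubic, smul_zero, add_zero, zero_add, Complex.ofReal_zero, mul_zero,
      zero_smul]
    refine Finset.sum_congr rfl fun y hy => ?_
    rw [Finset.mem_range] at hy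
    rw [smul_smul, hG]
    dsimp only
    rw [chainShift_add_two P (by omega : y + 2 ≤ m + 1), mul_comm]
    congr 2
  have e3 : laplacian (chainState P m n) = ∑ y ∈ Finset.range (m + 1),
      ((mixing P m y * (2 * (n + chainShift P m y) * (n + chainShift P m y + chainIndex P y)) : ℂ) •
        G y + (-2 * chainChi P y * mixing P m (y + 1) : ℂ) • G y
          + (-2 * chainMu y * mixing P m (y + 2) : ℂ) • G y) := by
    rw [Finset.sum_add_distrib, Finset.sum_add_distrib, ← e1, ← e2, chainState, map_sum,
      ← Finset.sum_add_distrib, ← Finset.sum_add_distrib]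
    refine Finset.sum_congr rfl fun y _ => ?_
    rw [map_smul, laplacian_chainBasis, smul_add, smul_add, smul_smul]
    push_cast
    rfl
  rw [e3, chainState, Finset.smul_sum]
  refine Finset.sum_congr rfl fun y hy => ?_
  have hy' : y ≤ m := by rw [Finset.mem_range] at hy; omega
  -- With α_m = α_y + 2s, the product (n+s)(n+s+α_y) exceeds n(n+α_m) by (α_m² - α_y²)/4, which is
  -- exactly what the recursion for Γ absorbs.
  have hcoef : (mixing P m y * (2 * (n + chainShift P m y) *
      (n + chainShift P m y + chainIndex P y)) + -2 * chainChi P y * mixing P m (y + 1)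
      + -2 * chainMu y * mixing P m (y + 2) : ℂ) =
      2 * n * (n + chainIndex P m) * mixing P m y := by
    have h1 := mixing_recurrence P hy'
    have h2 := chainIndex_eq P hy'
    rw [h2] at h1 ⊢
    have h3 := congrArg (fun x : ℝ => (x : ℂ)) h1
    push_cast at h3 ⊢
    linear_combination (1 / 2 : ℂ) * h3
  rw [← add_smul, ← add_smul, hcoef, smul_smul]
  -- At n = 0 the truncated index n - 1 is wrong, but the factor n vanishes.
  rcases n with _ | n
  · simp
  · rw [hG]
    dsimp only
    rw [show n + 1 + chainShift P m y - 1 = n + 1 - 1 + chainShift P m y by omega]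

theorem chainBasis_isHomogeneous (P : QuantaParity) (y j : ℕ) (A : Fin 8) :
    (chainBasis P y j A).IsHomogeneous (2 * j + 3 * y + (chainBrick P y).bosons) :=
  brickState_isHomogeneous _ _ _ _

/-- Hence all summands of a chain state have the same degree, and the cut-off keeps or kills the
chain state as a whole. -/
theorem quanta_chainShift (P : QuantaParity) {m y : ℕ} (h : y ≤ m) (n : ℕ) :
    2 * (n + chainShift P m y) + 3 * y + (chainBrick P y).bosons =
      2 * n + 3 * m + (chainBrick P m).bosons := by
  have := chainIndex_eq P h
  simp only [chainIndex] at this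
  omega

theorem chainState_isHomogeneous (P : QuantaParity) (m n : ℕ) (A : Fin 8) :
    (chainState P m n A).IsHomogeneous (2 * n + 3 * m + (chainBrick P m).bosons) := by
  rw [chainState, Finset.sum_apply]
  refine MvPolynomial.IsHomogeneous.sum _ _ _ fun y hy => ?_
  rw [Pi.smul_apply, MvPolynomial.smul_eq_C_mul,
    ← quanta_chainShift P (by rw [Finset.mem_range] at hy; omega : y ≤ m) n]
  exact (chainBasis_isHomogeneous P y _ A).C_mul _

theorem quadCreation_chainState (P : QuantaParity) (m n : ℕ) :
    quadCreation (chainState P m n) = chainState P m (n + 1) := by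
  rw [chainState, chainState, map_sum]
  refine Finset.sum_congr rfl fun y _ => ?_
  rw [map_smul, chainBasis, quadCreation_brickState, chainBasis]
  congr 2
  ring

theorem hamiltonian_chainState (P : QuantaParity) (m n : ℕ) :
    hamiltonian (chainState P m n) =
      (n + (chainIndex P m + 1) / 2 : ℂ) • chainState P m n
        - (1 / 2 : ℂ) • chainState P m (n + 1)
        - (1 / 2 * n * (n + chainIndex P m) : ℂ) • chainState P m (n - 1) := by
  rw [hamiltonian_of_homogeneous _ _ (chainState_isHomogeneous P m n), quadCreation_chainState,
    laplacian_chainState, smul_smul]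
  congr 2
  · congr 1
    simp only [chainIndex]
    push_cast
    ring
  · ring

theorem quantaCutoff_chainState (N : ℕ) (P : QuantaParity) (m n : ℕ) :
    quantaCutoff N (chainState P m n) =
      if 2 * n + 3 * m + (chainBrick P m).bosons ≤ N then chainState P m n else 0 := by
  have h : ∀ y ∈ Finset.range (m + 1), quantaCutoff N ((mixing P m y : ℂ) •
      chainBasis P y (n + chainShift P m y)) =
      if 2 * n + 3 * m + (chainBrick P m).bosons ≤ N then
        (mixing P m y : ℂ) • chainBasis P y (n + chainShift P m y) else 0 := fun y hy => by
    rw [map_smul, chainBasis, quantaCutoff_brickState, brickQuanta,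
      quanta_chainShift P (by rw [Finset.mem_range] at hy; omega : y ≤ m) n]
    split_ifs <;> simp
  rw [chainState, map_sum, Finset.sum_congr rfl h]
  split_ifs <;> simp

/-! ### Unitriangular changes of basis -/

section Unitriangular

variable {ι V : Type*} [AddCommGroup V] [Module ℂ V] {B D : ι → V}

theorem LinearIndependent.of_unitriangular (hB : LinearIndependent ℂ B) (r : ι → ℕ)
    (h : ∀ i, D i - B i ∈ Submodule.span ℂ (B '' {j | r j < r i})) : LinearIndependent ℂ D := by
  simp only [Finsupp.mem_span_image_iff_linearCombination] at h
  choose e he heq using h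
  have hD : ∀ i, D i = Finsupp.linearCombination ℂ B (Finsupp.single i 1 + e i) := fun i => by
    rw [map_add, heq, Finsupp.linearCombination_single, one_smul]
    abel
  rw [linearIndependent_iff]
  intro g hg
  -- At an index of maximal rank in the support, no other term contributes, so the coefficient there
  -- must vanish.
  by_contra hne
  obtain ⟨i₀, hi₀, hmax⟩ := Finset.exists_max_image g.support r
    (Finsupp.support_nonempty_iff.2 hne)
  have h1 : Finsupp.linearCombination ℂ B
      (g.sum fun i x => x • (Finsupp.single i 1 + e i)) = 0 := by
    rw [← hg, Finsupp.linearCombination_apply ℂ (v := D), Finsupp.sum, Finsupp.sum, map_sum]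
    exact Finset.sum_congr rfl fun i _ => by rw [map_smul, hD]
  have h2 := DFunLike.congr_fun (linearIndependent_iff.1 hB _ h1) i₀
  rw [Finsupp.sum, Finsupp.finsetSum_apply, Finset.sum_eq_single i₀] at h2
  · have h3 : e i₀ i₀ = 0 := by
      by_contra h4
      have h5 : r i₀ < r i₀ :=
        (Finsupp.mem_supported ℂ _).1 (he i₀) (Finsupp.mem_support_iff.2 h4)
      exact lt_irrefl _ h5
    simp [h3] at h2
    exact Finsupp.mem_support_iff.1 hi₀ h2
  · intro i hi hne'
    have h3 : e i i₀ = 0 := by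
      by_contra h4
      have h5 : r i₀ < r i := (Finsupp.mem_supported ℂ _).1 (he i) (Finsupp.mem_support_iff.2 h4)
      exact absurd (hmax i hi) (by omega)
    simp [h3, hne']
  · exact fun h' => absurd hi₀ h'

theorem span_image_eq_of_unitriangular (r : ι → ℕ) (S : Set ι)
    (h : ∀ i ∈ S, D i - B i ∈ Submodule.span ℂ (B '' {j | j ∈ S ∧ r j < r i})) :
    Submodule.span ℂ (D '' S) = Submodule.span ℂ (B '' S) := by
  apply le_antisymm
  · rw [Submodule.span_le]
    rintro _ ⟨i, hi, rfl⟩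
    rw [← sub_add_cancel (D i) (B i)]
    refine add_mem (Submodule.span_mono (Set.image_mono fun j hj => hj.1) (h i hi)) ?_
    exact Submodule.subset_span ⟨i, hi, rfl⟩
  · rw [Submodule.span_le]
    rintro _ ⟨i, hi, rfl⟩
    induction hr : r i using Nat.strong_induction_on generalizing i with
    | _ k ih =>
    rw [← sub_sub_cancel (D i) (B i)]
    refine sub_mem (Submodule.subset_span ⟨i, hi, rfl⟩) ?_
    refine Submodule.span_le.2 ?_ (h i hi)
    rintro _ ⟨j, ⟨hj, hlt⟩, rfl⟩
    exact ih (r j) (hr ▸ hlt) j hj rfl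

theorem LinearIndependent.mem_of_linearCombination_mem_span (hD : LinearIndependent ℂ D)
    {S : Set ι} {g : ι →₀ ℂ} (h : Finsupp.linearCombination ℂ D g ∈ Submodule.span ℂ (D '' S))
    {i : ι} (hi : g i ≠ 0) : i ∈ S := by
  rw [Finsupp.mem_span_image_iff_linearCombination] at h
  obtain ⟨l, hl, hlg⟩ := h
  rw [hD hlg] at hl
  exact (Finsupp.mem_supported ℂ _).1 hl (Finsupp.mem_support_iff.2 hi)

theorem LinearIndependent.mem_span_image_inter (hD : LinearIndependent ℂ D) {S T : Set ι} {x : V}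
    (hS : x ∈ Submodule.span ℂ (D '' S)) (hT : x ∈ Submodule.span ℂ (D '' T)) :
    x ∈ Submodule.span ℂ (D '' (S ∩ T)) := by
  obtain ⟨l, hl, rfl⟩ := (Finsupp.mem_span_image_iff_linearCombination ℂ).1 hS
  refine (Finsupp.mem_span_image_iff_linearCombination ℂ).2 ⟨l, ?_, rfl⟩
  rw [Finsupp.mem_supported]
  intro i hi
  exact ⟨(Finsupp.mem_supported ℂ _).1 hl hi,
    hD.mem_of_linearCombination_mem_span hT (Finsupp.mem_support_iff.1 hi)⟩

end Unitriangular

/-! ### Chain states as a basis of the cut-off space -/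

/-- The parity of the states with `k` cubic bricks and the fermionic brick `b`. -/
def brickParity (b : FermionicBrick) (k : ℕ) : QuantaParity :=
  match b with
  | .fa => if Even k then .odd else .even
  | .faa => if Even k then .even else .odd

/-- The labels of the basis states, by parity and numbers of cubic and quadratic bricks. -/
def chainEquiv : QuantaParity × ℕ × ℕ ≃ FermionicBrick × ℕ × ℕ where
  toFun i := (chainBrick i.1 i.2.1, i.2.2, i.2.1)
  invFun s := (brickParity s.1 s.2.2, s.2.2, s.2.1)
  left_inv := by
    rintro ⟨P, m, n⟩
    cases P <;> by_cases h : Even m <;> simp [chainBrick, brickParity, h]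
  right_inv := by
    rintro ⟨b, j, k⟩
    cases b <;> by_cases h : Even k <;> simp [chainBrick, brickParity, h]

theorem chainBasis_linearIndependent :
    LinearIndependent ℂ (fun i : QuantaParity × ℕ × ℕ => chainBasis i.1 i.2.1 i.2.2) :=
  brickState_linearIndependent.comp chainEquiv chainEquiv.injective

/-- The number of bosonic quanta of the states with label `i`. -/
def chainQuanta (i : QuantaParity × ℕ × ℕ) : ℕ :=
  2 * i.2.2 + 3 * i.2.1 + (chainBrick i.1 i.2.1).bosons

theorem chainState_sub_chainBasis (i : QuantaParity × ℕ × ℕ) :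
    chainState i.1 i.2.1 i.2.2 - chainBasis i.1 i.2.1 i.2.2 ∈ Submodule.span ℂ
      ((fun i : QuantaParity × ℕ × ℕ => chainBasis i.1 i.2.1 i.2.2) ''
        {j | j.1 = i.1 ∧ chainQuanta j = chainQuanta i ∧ j.2.1 < i.2.1}) := by
  obtain ⟨P, m, n⟩ := i
  dsimp only
  rw [chainState, Finset.sum_range_succ, mixing_self, chainShift_self, Complex.ofReal_one, one_smul,
    add_zero, add_sub_cancel_right]
  refine Submodule.sum_mem _ fun y hy => Submodule.smul_mem _ _ (Submodule.subset_span ?_)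
  rw [Finset.mem_range] at hy
  exact ⟨(P, y, n + chainShift P m y), ⟨rfl, quanta_chainShift P hy.le n, hy⟩, rfl⟩

theorem chainState_linearIndependent :
    LinearIndependent ℂ (fun i : QuantaParity × ℕ × ℕ => chainState i.1 i.2.1 i.2.2) :=
  chainBasis_linearIndependent.of_unitriangular (fun i => i.2.1) fun i =>
    Submodule.span_mono (Set.image_mono fun _ hj => hj.2.2) (chainState_sub_chainBasis i)

theorem span_chainState_image (S : Set (QuantaParity × ℕ × ℕ))
    (hS : ∀ i ∈ S, ∀ j, j.1 = i.1 → chainQuanta j = chainQuanta i → j.2.1 < i.2.1 → j ∈ S) :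
    Submodule.span ℂ ((fun i : QuantaParity × ℕ × ℕ => chainState i.1 i.2.1 i.2.2) '' S) =
      Submodule.span ℂ ((fun i : QuantaParity × ℕ × ℕ => chainBasis i.1 i.2.1 i.2.2) '' S) :=
  span_image_eq_of_unitriangular (fun i => i.2.1) S fun i hi => by
    refine Submodule.span_mono (Set.image_mono ?_) (chainState_sub_chainBasis i)
    rintro j ⟨h1, h2, h3⟩
    exact ⟨hS i hi j h1 h2 h3, h3⟩

/-- The corrections in a chain state preserve the number of quanta, so the triangular change of
basis respects the cut-off. -/
theorem cutSpace_eq_span_chainState (N : ℕ) : cutSpace N = Submodule.span ℂ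
    ((fun i : QuantaParity × ℕ × ℕ => chainState i.1 i.2.1 i.2.2) '' {i | chainQuanta i ≤ N}) := by
  rw [span_chainState_image _ fun i hi j _ h _ => by
    simp only [Set.mem_ofPred_eq] at hi ⊢; omega]
  rw [cutSpace]
  congr 1
  ext ψ
  constructor
  · rintro ⟨b, j, k, h, rfl⟩
    obtain ⟨i, hi⟩ := chainEquiv.surjective (b, j, k)
    simp only [chainEquiv, Equiv.coe_fn_mk, Prod.mk.injEq] at hi
    obtain ⟨rfl, rfl, rfl⟩ := hi
    exact ⟨i, h, rfl⟩
  · rintro ⟨i, h, rfl⟩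
    exact ⟨_, _, _, h, rfl⟩

/-! ### Laguerre eigenvectors of the cut Hamiltonian -/

/-- The number of states with `m` cubic bricks and at most `N` quanta. -/
def chainCount (N : ℕ) (P : QuantaParity) (m : ℕ) : ℕ :=
  (N + 2 - (3 * m + (chainBrick P m).bosons)) / 2

theorem lt_chainCount_iff (N : ℕ) (P : QuantaParity) (m n : ℕ) :
    n < chainCount N P m ↔ 2 * n + 3 * m + (chainBrick P m).bosons ≤ N := by
  simp only [chainCount]
  omega

/-- The eigenvector of energy `E` up to normalisation. -/
noncomputable def chainVector (P : QuantaParity) (m d : ℕ) (E : ℝ) : OneFermionFock :=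
  ∑ n ∈ Finset.range d, (((soninePoly (chainIndex P m) n).eval (2 * E) : ℝ) : ℂ) • chainState P m n

theorem soninePoly_eval_zero_ne (α : ℕ) (x : ℝ) : (soninePoly α 0).eval x ≠ 0 := by
  rw [soninePoly_zero, Polynomial.eval_C]
  positivity

/-- The recurrence cancels everything except at the upper end of the sum. The first boundary term
lies one step beyond the sum; the second carries the polynomial of the quantization condition.
Keeping both gives a statement valid for every E that can be proved by induction. -/
theorem hamiltonian_chainVector (P : QuantaParity) (m d : ℕ) (E : ℝ) :
    hamiltonian (chainVector P m (d + 1) E) = (E : ℂ) • chainVector P m (d + 1) E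
      - (1 / 2 * ((soninePoly (chainIndex P m) d).eval (2 * E) : ℝ) : ℂ) • chainState P m (d + 1)
      + (1 / 2 * (d + 1) * (d + 1 + chainIndex P m) *
          ((soninePoly (chainIndex P m) (d + 1)).eval (2 * E) : ℝ) : ℂ) • chainState P m d := by
  induction d with
  | zero =>
    have hrec := congrArg (Polynomial.eval (2 * E)) (soninePoly_one (chainIndex P m))
    simp only [Polynomial.eval_mul, Polynomial.eval_C, Polynomial.eval_sub, Polynomial.eval_X]
      at hrec
    have hrec' := congrArg (fun x : ℝ => (x : ℂ)) hrec
    simp only [chainVector, zero_add, Finset.sum_range_one, map_smul, hamiltonian_chainState]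
    push_cast at hrec' ⊢
    generalize (((soninePoly (chainIndex P m) 0).eval (2 * E) : ℝ) : ℂ) = c0 at *
    generalize (((soninePoly (chainIndex P m) 1).eval (2 * E) : ℝ) : ℂ) = c1 at *
    have : (c0 * ((chainIndex P m + 1) / 2) : ℂ) =
        E * c0 + 1 / 2 * (1 + chainIndex P m) * c1 := by
      linear_combination (-1 / 2 : ℂ) * hrec'
    simp only [zero_add, mul_zero, zero_mul, zero_smul, sub_zero, smul_sub, smul_smul, this,
      mul_one]
    module
  | succ d ih =>
    have hrec := congrArg (Polynomial.eval (2 * E)) (soninePoly_recurrence (chainIndex P m) d)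
    simp only [Polynomial.eval_mul, Polynomial.eval_C, Polynomial.eval_sub, Polynomial.eval_X]
      at hrec
    have hrec' := congrArg (fun x : ℝ => (x : ℂ)) hrec
    have hs : chainVector P m (d + 1 + 1) E = chainVector P m (d + 1) E
        + (((soninePoly (chainIndex P m) (d + 1)).eval (2 * E) : ℝ) : ℂ) •
          chainState P m (d + 1) := by
      rw [chainVector, Finset.sum_range_succ]
      rfl
    rw [hs, map_add, ih, map_smul, hamiltonian_chainState]
    push_cast at hrec' ⊢
    generalize (((soninePoly (chainIndex P m) d).eval (2 * E) : ℝ) : ℂ) = c0 at *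
    generalize (((soninePoly (chainIndex P m) (d + 1)).eval (2 * E) : ℝ) : ℂ) = c1 at *
    rw [show d + 1 + 1 = d + 2 by ring]
    generalize (((soninePoly (chainIndex P m) (d + 2)).eval (2 * E) : ℝ) : ℂ) = c2 at *
    have : (1 / 2 * (d + 1 + 1) * (d + 1 + 1 + chainIndex P m) * c2 : ℂ) =
        (d + 1 + (chainIndex P m + 1) / 2 - E) * c1 - 1 / 2 * c0 := by
      linear_combination (1 / 2 : ℂ) * hrec'
    rw [this]
    module

theorem quantaCutoff_chainVector (N : ℕ) (P : QuantaParity) (m : ℕ) (E : ℝ) :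
    quantaCutoff N (chainVector P m (chainCount N P m) E) =
      chainVector P m (chainCount N P m) E := by
  rw [chainVector, map_sum]
  refine Finset.sum_congr rfl fun n hn => ?_
  rw [Finset.mem_range, lt_chainCount_iff] at hn
  rw [map_smul, quantaCutoff_chainState, if_pos hn]

theorem cutHamiltonian_chainVector (N : ℕ) (P : QuantaParity) (m : ℕ) (E : ℝ)
    (hE : (soninePoly (chainIndex P m) (chainCount N P m)).eval (2 * E) = 0) :
    quantaCutoff N (hamiltonian (chainVector P m (chainCount N P m) E)) =
      (E : ℂ) • chainVector P m (chainCount N P m) E := by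
  rcases hd : chainCount N P m with _ | d
  · rw [hd] at hE
    exact absurd hE (soninePoly_eval_zero_ne _ _)
  · have h1 := quantaCutoff_chainVector N P m E
    -- The state just beyond the sum exceeds N quanta, so the projection removes it.
    have h2 := (lt_chainCount_iff N P m (d + 1)).not.1 (by omega)
    rw [hd] at hE h1
    rw [hamiltonian_chainVector, hE]
    simp only [map_sub, map_smul, h1, Complex.ofReal_zero, mul_zero, zero_smul, add_zero]
    rw [quantaCutoff_chainState, if_neg h2, smul_zero, sub_zero]

/-- The coefficient at n = 0 is a nonzero constant whatever E is. This gives both nonvanishing of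
the vector and membership in its family. -/
theorem mem_of_chainVector_mem_span (P : QuantaParity) (m d : ℕ) (E : ℝ) (hd : 0 < d)
    (S : Set (QuantaParity × ℕ × ℕ)) (h : chainVector P m d E ∈ Submodule.span ℂ
      ((fun i : QuantaParity × ℕ × ℕ => chainState i.1 i.2.1 i.2.2) '' S)) :
    (P, m, 0) ∈ S := by
  classical
  set g : QuantaParity × ℕ × ℕ →₀ ℂ := ∑ n ∈ Finset.range d,
    Finsupp.single (P, m, n) (((soninePoly (chainIndex P m) n).eval (2 * E) : ℝ) : ℂ) with hg
  have h1 : chainVector P m d E = Finsupp.linearCombination ℂ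
      (fun i : QuantaParity × ℕ × ℕ => chainState i.1 i.2.1 i.2.2) g := by
    rw [hg, map_sum, chainVector]
    exact Finset.sum_congr rfl fun n _ => by rw [Finsupp.linearCombination_single]
  rw [h1] at h
  refine chainState_linearIndependent.mem_of_linearCombination_mem_span h ?_
  rw [hg, Finsupp.finsetSum_apply, Finset.sum_eq_single 0]
  · simpa using soninePoly_eval_zero_ne _ _
  · intro n _ hn
    simp [hn]
  · intro h'
    simp at h'
    omega

theorem chainVector_ne_zero (P : QuantaParity) (m d : ℕ) (E : ℝ) (hd : 0 < d) :
    chainVector P m d E ≠ 0 := by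
  intro h
  exact mem_of_chainVector_mem_span P m d E hd ∅ (by rw [h]; exact zero_mem _)

/-! ### The four families identified with the chains -/

theorem Finset.sum_range_two_mul_eq {M : Type*} [AddCommMonoid M] (f : ℕ → M) (κ : ℕ) :
    ∑ y ∈ Finset.range (2 * κ), f y =
      ∑ q ∈ Finset.range κ, f (2 * q) + ∑ q ∈ Finset.range κ, f (2 * q + 1) := by
  induction κ with
  | zero => simp
  | succ κ ih =>
    rw [show 2 * (κ + 1) = 2 * κ + 1 + 1 by ring, Finset.sum_range_succ, Finset.sum_range_succ, ih,
      Finset.sum_range_succ, Finset.sum_range_succ]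
    abel

theorem Finset.sum_Icc_one_reflect {M : Type*} [AddCommMonoid M] (f : ℕ → M) (κ : ℕ) :
    ∑ p ∈ Finset.Icc 1 κ, f (κ - p) = ∑ q ∈ Finset.range κ, f q := by
  refine Finset.sum_nbij' (fun p => κ - p) (fun q => κ - q) ?_ ?_ ?_ ?_ ?_ <;>
    intro x hx <;> simp at hx ⊢ <;> omega

theorem Finset.sum_Icc_zero_reflect {M : Type*} [AddCommMonoid M] (f : ℕ → M) (κ : ℕ) :
    ∑ p ∈ Finset.Icc 0 κ, f (κ - p) = ∑ q ∈ Finset.range (κ + 1), f q := by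
  refine Finset.sum_nbij' (fun p => κ - p) (fun q => κ - q) ?_ ?_ ?_ ?_ ?_ <;>
    intro x hx <;> simp at hx ⊢ <;> omega

theorem chainBrick_two_mul_odd (q : ℕ) : chainBrick .odd (2 * q) = .fa := by
  simp [chainBrick]

theorem chainBrick_two_mul_add_one_odd (q : ℕ) : chainBrick .odd (2 * q + 1) = .faa := by
  simp [chainBrick]

theorem chainBrick_two_mul_even (q : ℕ) : chainBrick .even (2 * q) = .faa := by
  simp [chainBrick]

theorem chainBrick_two_mul_add_one_even (q : ℕ) : chainBrick .even (2 * q + 1) = .fa := by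
  simp [chainBrick]

namespace FamilyType

theorem chainBrick_eq (F : FamilyType) (κ : ℕ) :
    chainBrick F.parity (F.maxCubic κ) = F.leadingBrick := by
  cases F <;> simp [parity, maxCubic, leadingBrick, chainBrick]

theorem upperIndex_eq (F : FamilyType) (κ : ℕ) :
    F.upperIndex κ = 3 * F.maxCubic κ + 3 + F.leadingBrick.bosons := by
  cases F <;> simp only [upperIndex, maxCubic, leadingBrick, FermionicBrick.bosons] <;> ring

theorem chainIndex_eq_upperIndex (F : FamilyType) (κ : ℕ) :
    chainIndex F.parity (F.maxCubic κ) = F.upperIndex κ := by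
  rw [chainIndex, chainBrick_eq, upperIndex_eq]

theorem solutionCount_eq (N : ℕ) (F : FamilyType) (κ : ℕ) :
    F.solutionCount N κ = (N + 2 - (3 * F.maxCubic κ + F.leadingBrick.bosons)) / 2 := by
  cases F <;> simp only [solutionCount, maxCubic, leadingBrick, FermionicBrick.bosons] <;> omega

theorem chainCount_eq_solutionCount (N : ℕ) (F : FamilyType) (κ : ℕ) :
    chainCount N F.parity (F.maxCubic κ) = F.solutionCount N κ := by
  rw [chainCount, chainBrick_eq, solutionCount_eq]

/-- With the bricks fixed, the number of quanta determines the number of quadratic bricks. Matching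
a summand thus reduces to arithmetic; y' accommodates the different form of the truncated
subtractions. -/
theorem chainState_summand (P : QuantaParity) {m n y y' j : ℕ} {b : FermionicBrick} (hy : y = y')
    (hle : y ≤ m) (hb : chainBrick P y = b)
    (hj : 2 * j + 3 * y + b.bosons = 2 * n + 3 * m + (chainBrick P m).bosons) :
    (mixing P m y' : ℂ) • brickState b j y' =
      (mixing P m y : ℂ) • chainBasis P y (n + chainShift P m y) := by
  subst hy hb
  have := quanta_chainShift P hle n
  rw [chainBasis, show n + chainShift P m y = j by omega]

theorem dressedState_g1 (κ n : ℕ) : g1.dressedState κ n = chainState .odd (2 * κ) n := by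
  simp only [dressedState]
  rw [chainState, Finset.sum_range_succ, mixing_self, chainShift_self,
    Finset.sum_range_two_mul_eq, ← Finset.sum_Icc_one_reflect, ← Finset.sum_Icc_one_reflect,
    ← Finset.sum_add_distrib, chainBasis, chainBrick_two_mul_odd, Complex.ofReal_one, one_smul,
    add_zero, add_comm]
  refine congrArg₂ (· + ·) (Finset.sum_congr rfl fun p hp => ?_) rfl
  rw [Finset.mem_Icc] at hp
  rw [add_comm]
  refine congrArg₂ (· + ·) ?_ ?_
  · refine chainState_summand _ (by omega) (by omega) (chainBrick_two_mul_odd _) ?_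
    simp only [chainBrick_two_mul_odd]
    omega
  · refine chainState_summand _ (by omega) (by omega) (chainBrick_two_mul_add_one_odd _) ?_
    simp only [chainBrick_two_mul_odd, FermionicBrick.bosons]
    omega

theorem dressedState_g2 (κ n : ℕ) : g2.dressedState κ n = chainState .odd (2 * κ + 1) n := by
  simp only [dressedState]
  rw [chainState, show 2 * κ + 1 + 1 = 2 * (κ + 1) by ring, Finset.sum_range_two_mul_eq,
    Finset.sum_range_succ (fun q => _ • chainBasis _ (2 * q + 1) _), mixing_self,
    chainShift_self, ← Finset.sum_Icc_one_reflect, ← Finset.sum_Icc_one_reflect,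
    chainBasis, chainBrick_two_mul_add_one_odd, Complex.ofReal_one, one_smul, add_zero,
    add_assoc, add_comm (brickState _ _ _), add_assoc]
  refine congrArg₂ (· + ·) (Finset.sum_congr rfl fun p hp => ?_)
    (congrArg₂ (· + ·) (Finset.sum_congr rfl fun p hp => ?_) rfl) <;> rw [Finset.mem_Icc] at hp
  · refine chainState_summand _ (by omega) (by omega) (chainBrick_two_mul_odd _) ?_
    simp only [chainBrick_two_mul_add_one_odd, FermionicBrick.bosons]
    omega
  · refine chainState_summand _ (by omega) (by omega) (chainBrick_two_mul_add_one_odd _) ?_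
    simp only [chainBrick_two_mul_add_one_odd]
    omega

theorem dressedState_f1 (κ n : ℕ) : f1.dressedState κ n = chainState .even (2 * κ + 1) n := by
  simp only [dressedState]
  rw [chainState, show 2 * κ + 1 + 1 = 2 * (κ + 1) by ring, Finset.sum_range_two_mul_eq,
    Finset.sum_range_succ (fun q => _ • chainBasis _ (2 * q + 1) _), mixing_self,
    chainShift_self, ← Finset.sum_Icc_zero_reflect, ← Finset.sum_Icc_one_reflect,
    chainBasis, chainBrick_two_mul_add_one_even, Complex.ofReal_one, one_smul, add_zero,
    add_assoc, add_comm (brickState _ _ _), add_assoc]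
  refine congrArg₂ (· + ·) (Finset.sum_congr rfl fun p hp => ?_)
    (congrArg₂ (· + ·) (Finset.sum_congr rfl fun p hp => ?_) rfl) <;> rw [Finset.mem_Icc] at hp
  · refine chainState_summand _ (by omega) (by omega) (chainBrick_two_mul_even _) ?_
    simp only [chainBrick_two_mul_add_one_even, FermionicBrick.bosons]
    omega
  · refine chainState_summand _ (by omega) (by omega) (chainBrick_two_mul_add_one_even _) ?_
    simp only [chainBrick_two_mul_add_one_even]
    omega

theorem dressedState_f2 (κ n : ℕ) : f2.dressedState κ n = chainState .even (2 * κ) n := by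
  simp only [dressedState]
  rw [chainState, Finset.sum_range_succ, mixing_self, chainShift_self,
    Finset.sum_range_two_mul_eq, ← Finset.sum_Icc_one_reflect, ← Finset.sum_Icc_one_reflect,
    ← Finset.sum_add_distrib, chainBasis, chainBrick_two_mul_even, Complex.ofReal_one, one_smul,
    add_zero, add_comm]
  refine congrArg₂ (· + ·) (Finset.sum_congr rfl fun p hp => ?_) rfl
  rw [Finset.mem_Icc] at hp
  rw [add_comm]
  refine congrArg₂ (· + ·) ?_ ?_
  · refine chainState_summand _ (by omega) (by omega) (chainBrick_two_mul_even _) ?_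
    simp only [chainBrick_two_mul_even]
    omega
  · refine chainState_summand _ (by omega) (by omega) (chainBrick_two_mul_add_one_even _) ?_
    simp only [chainBrick_two_mul_even, FermionicBrick.bosons]
    omega

theorem dressedState_eq (F : FamilyType) (κ n : ℕ) :
    F.dressedState κ n = chainState F.parity (F.maxCubic κ) n := by
  cases F
  · exact dressedState_g1 κ n
  · exact dressedState_g2 κ n
  · exact dressedState_f1 κ n
  · exact dressedState_f2 κ n

theorem exists_parity_maxCubic_eq (P : QuantaParity) (m : ℕ) :
    ∃ (F : FamilyType) (κ : ℕ), F.parity = P ∧ F.maxCubic κ = m := by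
  rcases Nat.even_or_odd' m with ⟨κ, rfl | rfl⟩ <;> cases P
  · exact ⟨g1, κ, rfl, rfl⟩
  · exact ⟨f2, κ, rfl, rfl⟩
  · exact ⟨g2, κ, rfl, rfl⟩
  · exact ⟨f1, κ, rfl, rfl⟩

theorem eq_of_parity_maxCubic_eq {F F' : FamilyType} {κ κ' : ℕ} (h : F.parity = F'.parity)
    (h' : F.maxCubic κ = F'.maxCubic κ') : F = F' ∧ κ = κ' := by
  cases F <;> cases F' <;> simp [parity, maxCubic] at h h' ⊢ <;> omega

theorem exists_leadingBrick_maxCubic_eq (b : FermionicBrick) (m : ℕ) :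
    ∃ (F : FamilyType) (κ : ℕ), F.leadingBrick = b ∧ F.maxCubic κ = m := by
  rcases Nat.even_or_odd' m with ⟨κ, rfl | rfl⟩ <;> cases b
  · exact ⟨g1, κ, rfl, rfl⟩
  · exact ⟨f2, κ, rfl, rfl⟩
  · exact ⟨f1, κ, rfl, rfl⟩
  · exact ⟨g2, κ, rfl, rfl⟩

theorem pos_of_mem_energies {N : ℕ} {F : FamilyType} {κ : ℕ} {E : ℝ} (hE : E ∈ F.energies N κ) :
    0 < E := by
  by_contra h
  have := soninePoly_eval_pos (F.upperIndex κ) (F.solutionCount N κ) (x := 2 * E) (by linarith)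
  exact this.ne' hE

theorem solutionCount_pos {N : ℕ} {F : FamilyType} {κ : ℕ} {E : ℝ} (hE : E ∈ F.energies N κ) :
    0 < F.solutionCount N κ := by
  by_contra h
  have h0 : F.solutionCount N κ = 0 := by omega
  have hE' : (soninePoly (F.upperIndex κ) (F.solutionCount N κ)).eval (2 * E) = 0 := hE
  rw [h0] at hE'
  exact soninePoly_eval_zero_ne _ _ hE'

theorem encard_energies (N : ℕ) (F : FamilyType) (κ : ℕ) :
    (F.energies N κ).encard = F.solutionCount N κ := by
  set p := soninePoly (F.upperIndex κ) (F.solutionCount N κ) with hp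
  have h1 : F.energies N κ = (fun x : ℝ => x / 2) '' (p.roots.toFinset : Set ℝ) := by
    ext E
    simp only [energies, Set.mem_image, Finset.mem_coe, Multiset.mem_toFinset,
      Polynomial.mem_roots', Polynomial.IsRoot]
    constructor
    · intro h
      exact ⟨2 * E, ⟨soninePoly_ne_zero _ _, h⟩, by ring⟩
    · rintro ⟨x, ⟨-, hx⟩, rfl⟩
      change p.eval (2 * (x / 2)) = 0
      rwa [mul_div_cancel₀ x two_ne_zero]
  rw [h1, Function.Injective.encard_image, Set.encard_coe_eq_coe_finsetCard, hp,
    soninePoly_card_roots]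
  intro x y hxy
  simpa using hxy

theorem exists_eigenstate_eq_smul {N : ℕ} {F : FamilyType} {κ : ℕ} {E : ℝ}
    (hE : E ∈ F.energies N κ) : ∃ c : ℂ, c ≠ 0 ∧ F.eigenstate N κ E =
      c • chainVector F.parity (F.maxCubic κ) (F.solutionCount N κ) E := by
  have hpos := pos_of_mem_energies hE
  refine ⟨(((2 * E) ^ F.normExponent κ * Real.exp (-E) : ℝ) : ℂ), ?_, ?_⟩
  · rw [Ne, Complex.ofReal_eq_zero]
    have : 0 < 2 * E := by linarith
    positivity
  · simp only [eigenstate, chainVector, chainIndex_eq_upperIndex, dressedState_eq]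

theorem isCutEigenstate_eigenstate {N : ℕ} {F : FamilyType} {κ : ℕ} {E : ℝ}
    (hE : E ∈ F.energies N κ) : IsCutEigenstate N E (F.eigenstate N κ E) := by
  obtain ⟨c, hc, h⟩ := exists_eigenstate_eq_smul hE
  rw [h]
  refine ⟨Submodule.smul_mem _ _ ?_, smul_ne_zero hc
    (chainVector_ne_zero _ _ _ _ (solutionCount_pos hE)), ?_⟩
  · rw [cutSpace_eq_span_chainState]
    refine Submodule.sum_mem _ fun n hn => Submodule.smul_mem _ _ (Submodule.subset_span ?_)
    rw [Finset.mem_range, ← chainCount_eq_solutionCount, lt_chainCount_iff] at hn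
    exact ⟨(F.parity, F.maxCubic κ, n), hn, rfl⟩
  · rw [map_smul, map_smul, ← chainCount_eq_solutionCount, cutHamiltonian_chainVector, smul_comm]
    rw [chainCount_eq_solutionCount, chainIndex_eq_upperIndex]
    exact hE

/-- The parity of a state with label `i` is that of its number of quanta. -/
theorem quantaParity_iff (P : QuantaParity) (i : QuantaParity × ℕ × ℕ) :
    (match P with
      | .odd => Odd (chainQuanta i)
      | .even => Even (chainQuanta i)) ↔ i.1 = P := by
  obtain ⟨P', m, n⟩ := i
  rcases Nat.even_or_odd' m with ⟨q, rfl | rfl⟩ <;> cases P <;> cases P' <;>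
    simp [chainQuanta, chainBrick_two_mul_odd, chainBrick_two_mul_even,
      chainBrick_two_mul_add_one_odd, chainBrick_two_mul_add_one_even, FermionicBrick.bosons,
      parity_simps]

/-- The condition on the leading brick is automatic, since parity and number of cubic bricks
determine it. What remains is a step of the filtration by cubic bricks, which passes to chain states
by triangularity. -/
theorem contains_iff (F : FamilyType) (κ : ℕ) (ψ : OneFermionFock) :
    F.Contains κ ψ ↔
      ψ ∈ Submodule.span ℂ ((fun i : QuantaParity × ℕ × ℕ => chainBasis i.1 i.2.1 i.2.2) ''
        {i | i.1 = F.parity ∧ i.2.1 ≤ F.maxCubic κ}) ∧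
      ψ ∉ Submodule.span ℂ ((fun i : QuantaParity × ℕ × ℕ => chainBasis i.1 i.2.1 i.2.2) ''
        {i | i.1 = F.parity ∧ i.2.1 < F.maxCubic κ}) := by
  have hlc : ∀ l : QuantaParity × ℕ × ℕ →₀ ℂ,
      (Finsupp.equivMapDomain chainEquiv l).sum (fun s x => x • brickState s.1 s.2.1 s.2.2) =
      Finsupp.linearCombination ℂ
        (fun i : QuantaParity × ℕ × ℕ => chainBasis i.1 i.2.1 i.2.2) l := by
    intro l
    rw [← Finsupp.linearCombination_apply, Finsupp.linearCombination_equivMapDomain]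
    rfl
  have hsupp : ∀ l : QuantaParity × ℕ × ℕ →₀ ℂ, ∀ i,
      chainEquiv i ∈ (Finsupp.equivMapDomain chainEquiv l).support ↔ i ∈ l.support := by
    intro l i
    simp [Finsupp.equivMapDomain_apply]
  constructor
  · rintro ⟨c, rfl, hc, s, hs, hsk⟩
    obtain ⟨l, rfl⟩ : ∃ l, c = Finsupp.equivMapDomain chainEquiv l :=
      ⟨Finsupp.equivMapDomain chainEquiv.symm c, by
        ext s; simp [Finsupp.equivMapDomain_apply]⟩
    obtain ⟨i, rfl⟩ := chainEquiv.surjective s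
    rw [hsupp] at hs
    rw [hlc]
    constructor
    · refine (Finsupp.mem_span_image_iff_linearCombination ℂ).2 ⟨l, ?_, rfl⟩
      rw [Finsupp.mem_supported]
      intro i' hi'
      obtain ⟨h1, h2, -⟩ := hc (chainEquiv i') ((hsupp l i').2 hi')
      exact ⟨(quantaParity_iff F.parity i').1 h1, h2⟩
    · intro hmem
      obtain ⟨-, hlt⟩ := chainBasis_linearIndependent.mem_of_linearCombination_mem_span hmem
        (Finsupp.mem_support_iff.1 hs)
      exact hlt.ne hsk
  · rintro ⟨hmem, hnot⟩
    obtain ⟨l, hl, rfl⟩ := (Finsupp.mem_span_image_iff_linearCombination ℂ).1 hmem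
    rw [Finsupp.mem_supported] at hl
    refine ⟨Finsupp.equivMapDomain chainEquiv l, (hlc l).symm, ?_, ?_⟩
    · intro s hs
      obtain ⟨i, rfl⟩ := chainEquiv.surjective s
      rw [hsupp] at hs
      obtain ⟨h1, h2⟩ := hl hs
      refine ⟨(quantaParity_iff F.parity i).2 h1, h2, fun h3 => ?_⟩
      rw [← chainBrick_eq F κ, ← h1, ← h3]
      rfl
    · by_contra hno
      push Not at hno
      refine hnot ((Finsupp.mem_span_image_iff_linearCombination ℂ).2 ⟨l, ?_, rfl⟩)
      rw [Finsupp.mem_supported]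
      intro i hi
      obtain ⟨h1, h2⟩ := hl hi
      exact ⟨h1, lt_of_le_of_ne h2 (hno (chainEquiv i) ((hsupp l i).2 hi))⟩

theorem contains_iff_chainState (F : FamilyType) (κ : ℕ) (ψ : OneFermionFock) :
    F.Contains κ ψ ↔
      ψ ∈ Submodule.span ℂ ((fun i : QuantaParity × ℕ × ℕ => chainState i.1 i.2.1 i.2.2) ''
        {i | i.1 = F.parity ∧ i.2.1 ≤ F.maxCubic κ}) ∧
      ψ ∉ Submodule.span ℂ ((fun i : QuantaParity × ℕ × ℕ => chainState i.1 i.2.1 i.2.2) ''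
        {i | i.1 = F.parity ∧ i.2.1 < F.maxCubic κ}) := by
  rw [contains_iff, span_chainState_image, span_chainState_image]
  · rintro i ⟨h1, h2⟩ j hj - hlt
    exact ⟨hj.trans h1, hlt.trans h2⟩
  · rintro i ⟨h1, h2⟩ j hj - hlt
    exact ⟨hj.trans h1, hlt.le.trans h2⟩

theorem contains_eigenstate {N : ℕ} {F : FamilyType} {κ : ℕ} {E : ℝ}
    (hE : E ∈ F.energies N κ) : F.Contains κ (F.eigenstate N κ E) := by
  obtain ⟨c, hc, h⟩ := exists_eigenstate_eq_smul hE
  rw [h, contains_iff_chainState, Submodule.smul_mem_iff _ hc, Submodule.smul_mem_iff _ hc]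
  constructor
  · refine Submodule.sum_mem _ fun n hn => Submodule.smul_mem _ _ (Submodule.subset_span ?_)
    exact ⟨(F.parity, F.maxCubic κ, n), ⟨rfl, le_rfl⟩, rfl⟩
  · intro hmem
    exact lt_irrefl _ (mem_of_chainVector_mem_span _ _ _ _ (solutionCount_pos hE) _ hmem).2

end FamilyType

/-! ### Completeness of the eigenstates -/

namespace FamilyType

theorem finite_energies (N : ℕ) (F : FamilyType) (κ : ℕ) : Finite (F.energies N κ) :=
  Set.finite_of_encard_eq_coe (encard_energies N F κ)

theorem natCard_energies (N : ℕ) (F : FamilyType) (κ : ℕ) :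
    Nat.card (F.energies N κ) = F.solutionCount N κ := by
  rw [Nat.card_coe_set_eq, Set.ncard, encard_energies]
  rfl

theorem hasEigenvector_eigenstate (N : ℕ) (F : FamilyType) (κ : ℕ) (E : F.energies N κ) :
    Module.End.HasEigenvector (quantaCutoff N ∘ₗ hamiltonian : Module.End ℂ OneFermionFock)
      ((E : ℝ) : ℂ) (F.eigenstate N κ E) := by
  obtain ⟨-, h1, h2⟩ := isCutEigenstate_eigenstate E.2
  exact ⟨Module.End.mem_eigenspace_iff.2 h2, h1⟩

theorem eigenstate_mem_span_chainState {N : ℕ} {F : FamilyType} {κ : ℕ} {E : ℝ}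
    (hE : E ∈ F.energies N κ) : F.eigenstate N κ E ∈ Submodule.span ℂ (Set.range
      fun n : Fin (F.solutionCount N κ) => chainState F.parity (F.maxCubic κ) n) := by
  obtain ⟨c, -, h⟩ := exists_eigenstate_eq_smul hE
  rw [h]
  refine Submodule.smul_mem _ _ (Submodule.sum_mem _ fun n hn => Submodule.smul_mem _ _
    (Submodule.subset_span ?_))
  exact ⟨⟨n, Finset.mem_range.1 hn⟩, rfl⟩

/-- The eigenstates of a family span the same space as its dressed states below the cut-off. -/
theorem span_eigenstate (N : ℕ) (F : FamilyType) (κ : ℕ) :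
    Submodule.span ℂ (Set.range fun E : F.energies N κ => F.eigenstate N κ E) =
      Submodule.span ℂ (Set.range
        fun n : Fin (F.solutionCount N κ) => chainState F.parity (F.maxCubic κ) n) := by
  have := finite_energies N F κ
  have := Fintype.ofFinite (F.energies N κ)
  have hli : LinearIndependent ℂ (fun E : F.energies N κ => F.eigenstate N κ E) :=
    Module.End.eigenvectors_linearIndependent' _ (fun E : F.energies N κ => ((E : ℝ) : ℂ))
      (fun x y h => Subtype.ext (Complex.ofReal_injective h)) _ (hasEigenvector_eigenstate N F κ)
  have := FiniteDimensional.span_of_finite ℂ (Set.finite_range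
    fun n : Fin (F.solutionCount N κ) => chainState F.parity (F.maxCubic κ) n)
  -- Eigenvectors with distinct energies are independent, and there are as many of them as spanning
  -- chain states.
  refine Submodule.eq_of_le_of_finrank_le ?_ ?_
  · rw [Submodule.span_le]
    rintro _ ⟨E, rfl⟩
    exact eigenstate_mem_span_chainState E.2
  · rw [finrank_span_eq_card hli, ← Nat.card_eq_fintype_card, natCard_energies]
    exact (finrank_range_le_card _).trans (Fintype.card_fin _).le

end FamilyType

open FamilyType

theorem span_cutSolution (N : ℕ) : Submodule.span ℂ
    (Set.range fun s : CutSolution N => s.1.1.eigenstate N s.1.2.1 s.1.2.2) = cutSpace N := by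
  apply le_antisymm
  · rw [Submodule.span_le]
    rintro _ ⟨s, rfl⟩
    exact (isCutEigenstate_eigenstate s.2).1
  · rw [cutSpace_eq_span_chainState, Submodule.span_le]
    rintro _ ⟨⟨P, m, n⟩, hi, rfl⟩
    obtain ⟨F, κ, rfl, rfl⟩ := exists_parity_maxCubic_eq P m
    have hn : n < F.solutionCount N κ := by
      rw [← chainCount_eq_solutionCount, lt_chainCount_iff]
      exact hi
    have h1 : chainState F.parity (F.maxCubic κ) n ∈ Submodule.span ℂ (Set.range
        fun n : Fin (F.solutionCount N κ) => chainState F.parity (F.maxCubic κ) n) :=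
      Submodule.subset_span ⟨⟨n, hn⟩, rfl⟩
    rw [← span_eigenstate] at h1
    refine Submodule.span_mono ?_ h1
    rintro _ ⟨E, rfl⟩
    exact ⟨⟨(F, κ, E), E.2⟩, rfl⟩

/-- There are as many solutions as basis states. -/
noncomputable def cutSolutionEquiv (N : ℕ) :
    CutSolution N ≃ {i : QuantaParity × ℕ × ℕ // chainQuanta i ≤ N} :=
  let e₁ : CutSolution N ≃ Σ p : FamilyType × ℕ, p.1.energies N p.2 :=
    { toFun := fun s => ⟨(s.1.1, s.1.2.1), ⟨s.1.2.2, s.2⟩⟩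
      invFun := fun t => ⟨(t.1.1, t.1.2, t.2.1), t.2.2⟩
      left_inv := fun _ => rfl
      right_inv := fun _ => rfl }
  let e₂ : (Σ p : FamilyType × ℕ, p.1.energies N p.2) ≃
      Σ p : FamilyType × ℕ, Fin (p.1.solutionCount N p.2) :=
    Equiv.sigmaCongrRight fun p =>
      have := finite_energies N p.1 p.2
      Finite.equivFinOfCardEq (natCard_energies N p.1 p.2)
  let e₃ : (Σ p : FamilyType × ℕ, Fin (p.1.solutionCount N p.2)) ≃
      {i : QuantaParity × ℕ × ℕ // chainQuanta i ≤ N} :=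
    Equiv.ofBijective (fun t => ⟨(t.1.1.parity, t.1.1.maxCubic t.1.2, t.2), by
        have h := t.2.2.trans_eq (chainCount_eq_solutionCount N t.1.1 t.1.2).symm
        exact (lt_chainCount_iff _ _ _ _).1 h⟩) (by
      constructor
      · rintro ⟨⟨F, κ⟩, n⟩ ⟨⟨F', κ'⟩, n'⟩ h
        have h1 : F.parity = F'.parity := congrArg (fun i => i.1.1) h
        have h2 : F.maxCubic κ = F'.maxCubic κ' := congrArg (fun i => i.1.2.1) h
        have h3 : (n : ℕ) = n' := congrArg (fun i => i.1.2.2) h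
        obtain ⟨rfl, rfl⟩ := eq_of_parity_maxCubic_eq h1 h2
        obtain rfl := Fin.ext h3
        rfl
      · rintro ⟨⟨P, m, n⟩, hi⟩
        obtain ⟨F, κ, rfl, rfl⟩ := exists_parity_maxCubic_eq P m
        refine ⟨⟨(F, κ), ⟨n, ?_⟩⟩, rfl⟩
        rw [← chainCount_eq_solutionCount, lt_chainCount_iff]
        exact hi)
  e₁.trans (e₂.trans e₃)

theorem finite_chainQuanta_le (N : ℕ) :
    Finite {i : QuantaParity × ℕ × ℕ // chainQuanta i ≤ N} := by
  have h : Function.Injective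
      (fun i : {i : QuantaParity × ℕ × ℕ // chainQuanta i ≤ N} =>
        ((match i.1.1 with | .odd => true | .even => false,
          (⟨i.1.2.1, by have := i.2; simp only [chainQuanta] at this; omega⟩ : Fin (N + 1)),
          (⟨i.1.2.2, by have := i.2; simp only [chainQuanta] at this; omega⟩ : Fin (N + 1))) :
          Bool × Fin (N + 1) × Fin (N + 1))) := by
    rintro ⟨⟨P, m, n⟩, hi⟩ ⟨⟨P', m', n'⟩, hi'⟩ h
    cases P <;> cases P' <;> simp_all
  exact Finite.of_injective _ h

/-- Energies of different families are not known to differ, so distinct eigenvalues do not suffice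
here. Instead, the solutions span a space whose dimension equals their number. -/
theorem cutSolution_linearIndependent (N : ℕ) : LinearIndependent ℂ
    (fun s : CutSolution N => s.1.1.eigenstate N s.1.2.1 s.1.2.2) := by
  have := finite_chainQuanta_le N
  have := Fintype.ofFinite {i : QuantaParity × ℕ × ℕ // chainQuanta i ≤ N}
  have := Fintype.ofEquiv _ (cutSolutionEquiv N).symm
  have hli := chainState_linearIndependent.comp
    (Subtype.val : {i : QuantaParity × ℕ × ℕ // chainQuanta i ≤ N} → _) Subtype.val_injective
  rw [linearIndependent_iff_card_eq_finrank_span, Set.finrank, span_cutSolution,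
    cutSpace_eq_span_chainState, Fintype.card_congr (cutSolutionEquiv N),
    ← finrank_span_eq_card hli, Set.range_comp, Subtype.range_coe_subtype]

/-- In the eigenbasis, each coefficient is annihilated by the difference between its energy and E.
-/
theorem mem_span_of_isCutEigenstate {N : ℕ} {E : ℂ} {ψ : OneFermionFock}
    (h : IsCutEigenstate N E ψ) : ψ ∈ Submodule.span ℂ {φ | ∃ (F : FamilyType) (κ : ℕ),
      ∃ x ∈ F.energies N κ, (x : ℂ) = E ∧ φ = F.eigenstate N κ x} := by
  obtain ⟨hψ, -, heig⟩ := h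
  rw [← span_cutSolution, Finsupp.mem_span_range_iff_exists_finsupp] at hψ
  obtain ⟨g, rfl⟩ := hψ
  rw [Finsupp.sum, map_sum, map_sum, Finset.smul_sum, ← sub_eq_zero,
    ← Finset.sum_sub_distrib] at heig
  have h1 : ∀ s : CutSolution N, quantaCutoff N (hamiltonian
      (g s • s.1.1.eigenstate N s.1.2.1 s.1.2.2)) - E • g s • s.1.1.eigenstate N s.1.2.1 s.1.2.2 =
      (g s * ((s.1.2.2 : ℂ) - E)) • s.1.1.eigenstate N s.1.2.1 s.1.2.2 := by
    intro s
    rw [map_smul, map_smul, (isCutEigenstate_eigenstate s.2).2.2, smul_smul, smul_smul,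
      ← sub_smul]
    congr 1
    ring
  simp only [h1] at heig
  have h2 := linearIndependent_iff'.1 (cutSolution_linearIndependent N) g.support _ heig
  refine Submodule.sum_mem _ fun s hs => Submodule.smul_mem _ _ (Submodule.subset_span ?_)
  have h3 := (mul_eq_zero.1 (h2 s hs)).resolve_left (Finsupp.mem_support_iff.1 hs)
  exact ⟨s.1.1, s.1.2.1, s.1.2.2, s.2, sub_eq_zero.1 h3, rfl⟩

theorem exists_mem_energies_of_contains {N : ℕ} {F : FamilyType} {κ : ℕ} {E : ℂ}
    {ψ : OneFermionFock} (h : IsCutEigenstate N E ψ) (hc : F.Contains κ ψ) :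
    ∃ x ∈ F.energies N κ, E = x := by
  by_contra hno
  push Not at hno
  rw [contains_iff_chainState] at hc
  refine hc.2 ?_
  -- If E is not an energy of the family, only eigenstates of other chains enter ψ. The leading
  -- chain is then absent, contrary to membership in the family.
  have h1 : ψ ∈ Submodule.span ℂ
      ((fun i : QuantaParity × ℕ × ℕ => chainState i.1 i.2.1 i.2.2) ''
        {i | ¬ (i.1 = F.parity ∧ i.2.1 = F.maxCubic κ)}) := by
    refine Submodule.span_le.2 ?_ (mem_span_of_isCutEigenstate h)
    rintro _ ⟨F', κ', x, hx, hxE, rfl⟩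
    refine Submodule.span_mono ?_ (eigenstate_mem_span_chainState hx)
    rintro _ ⟨n, rfl⟩
    refine ⟨(F'.parity, F'.maxCubic κ', n), ?_, rfl⟩
    rintro ⟨h2, h3⟩
    obtain ⟨rfl, rfl⟩ := eq_of_parity_maxCubic_eq h2 h3
    exact hno x hx hxE.symm
  refine Submodule.span_mono (Set.image_mono ?_)
    (chainState_linearIndependent.mem_span_image_inter hc.1 h1)
  rintro i ⟨⟨h2, h3⟩, h4⟩
  exact ⟨h2, lt_of_le_of_ne h3 fun h5 => h4 ⟨h2, h5⟩⟩

/-! ### The spectrum as the roots of Θ -/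

theorem exists_isCutEigenstate_iff (N : ℕ) (E : ℂ) : (∃ ψ, IsCutEigenstate N E ψ) ↔
    ∃ (F : FamilyType) (κ : ℕ), ∃ x ∈ F.energies N κ, (x : ℂ) = E := by
  constructor
  · rintro ⟨ψ, h⟩
    have hmem := mem_span_of_isCutEigenstate h
    by_contra hno
    push Not at hno
    have hempty : {φ | ∃ (F : FamilyType) (κ : ℕ), ∃ x ∈ F.energies N κ, (x : ℂ) = E ∧
        φ = F.eigenstate N κ x} = ∅ := by
      rw [Set.eq_empty_iff_forall_notMem]
      rintro φ ⟨F, κ, x, hx, hxE, -⟩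
      exact hno F κ x hx hxE
    rw [hempty, Submodule.span_empty, Submodule.mem_bot] at hmem
    exact h.2.1 hmem
  · rintro ⟨F, κ, x, hx, rfl⟩
    exact ⟨_, isCutEigenstate_eigenstate hx⟩

theorem exists_mem_energies_iff (N : ℕ) (F : FamilyType) (κ : ℕ) (E : ℂ) :
    (∃ x ∈ F.energies N κ, (x : ℂ) = E) ↔
      Polynomial.aeval (2 * E) (soninePoly (F.upperIndex κ) (F.solutionCount N κ)) = 0 := by
  constructor
  · rintro ⟨x, hx, rfl⟩
    have h : (soninePoly (F.upperIndex κ) (F.solutionCount N κ)).eval (2 * x) = 0 := hx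
    rw [show (2 * (x : ℂ)) = algebraMap ℝ ℂ (2 * x) by simp, Polynomial.aeval_algebraMap_apply,
      Polynomial.coe_aeval_eq_eval, h, map_zero]
  · intro h
    obtain ⟨y, hy, hyE⟩ := soninePoly_aeval_eq_zero _ _ h
    refine ⟨y / 2, ?_, ?_⟩
    · change (soninePoly _ _).eval (2 * (y / 2)) = 0
      rwa [mul_div_cancel₀ y two_ne_zero]
    · push_cast
      rw [← hyE]
      ring

theorem aeval_thetaPoly_eq_zero_iff (N : ℕ) (E : ℂ) :
    Polynomial.aeval E (thetaPoly N) = 0 ↔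
      ∃ (b : FermionicBrick) (m : ℕ), Polynomial.aeval (2 * E)
        (soninePoly (3 * m + 3 + b.bosons) ((N + 2 - (3 * m + b.bosons)) / 2)) = 0 := by
  have hcomp : ∀ p : Polynomial ℝ, Polynomial.aeval E (p.comp (Polynomial.C 2 * Polynomial.X)) =
      Polynomial.aeval (2 * E) p := by
    intro p
    rw [Polynomial.aeval_comp]
    simp
  -- A factor of degree 0 is a nonzero constant; this is why the finite products see every m.
  have hlt : ∀ α d, Polynomial.aeval (2 * E) (soninePoly α d) = 0 → 0 < d := by
    intro α d h
    by_contra hd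
    obtain ⟨x, hx, -⟩ := soninePoly_aeval_eq_zero α d h
    rw [show d = 0 by omega] at hx
    exact soninePoly_eval_zero_ne _ _ hx
  have hd1 : ∀ m : ℕ, (((N : ℤ) - 3 * m - 1) / 2 + 1).toNat = (N + 2 - (3 * m + 1)) / 2 :=
    fun m => by omega
  have hd2 : ∀ m : ℕ, (((N : ℤ) - 3 * m - 2) / 2 + 1).toNat = (N + 2 - (3 * m + 2)) / 2 :=
    fun m => by omega
  rw [thetaPoly, map_mul, map_prod, map_prod, mul_eq_zero, Finset.prod_eq_zero_iff,
    Finset.prod_eq_zero_iff]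
  simp only [hcomp, hd1, hd2, Finset.mem_range]
  constructor
  · rintro (⟨m, -, h⟩ | ⟨m, -, h⟩)
    · exact ⟨.fa, m, h⟩
    · exact ⟨.faa, m, h⟩
  · rintro ⟨b, m, h⟩
    have hpos := hlt _ _ h
    cases b
    · simp only [FermionicBrick.bosons] at hpos
      exact Or.inl ⟨m, by omega, h⟩
    · simp only [FermionicBrick.bosons] at hpos
      exact Or.inr ⟨m, by omega, h⟩

theorem mainTheorem2 (N : ℕ) :
    -- the states built with the bricks are linearly independent
    LinearIndependent ℂ
      (fun s : FermionicBrick × ℕ × ℕ => brickState s.1 s.2.1 s.2.2) ∧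
    -- the quantization condition of each family has as many solutions as stated, all positive
    (∀ (F : FamilyType) (κ : ℕ),
      (F.energies N κ).encard = F.solutionCount N κ ∧ ∀ E ∈ F.energies N κ, 0 < E) ∧
    -- each energy of a family comes with the explicit eigenstate, which belongs to the family
    (∀ (F : FamilyType) (κ : ℕ), ∀ E ∈ F.energies N κ,
      IsCutEigenstate N E (F.eigenstate N κ E) ∧ F.Contains κ (F.eigenstate N κ E)) ∧
    -- eigenstates of a family occur only at its quantized energies
    (∀ (F : FamilyType) (κ : ℕ) (E : ℂ) (ψ : OneFermionFock),
      IsCutEigenstate N E ψ → F.Contains κ ψ → ∃ x ∈ F.energies N κ, E = x) ∧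
    -- the solutions of all families together form a basis of the cut-off space
    LinearIndependent ℂ
      (fun s : CutSolution N => s.1.1.eigenstate N s.1.2.1 s.1.2.2) ∧
    Submodule.span ℂ
      (Set.range fun s : CutSolution N => s.1.1.eigenstate N s.1.2.1 s.1.2.2) = cutSpace N ∧
    -- every eigenstate of energy `E` is a combination of the solutions of energy `E`
    (∀ (E : ℂ) (ψ : OneFermionFock), IsCutEigenstate N E ψ →
      ψ ∈ Submodule.span ℂ {φ | ∃ (F : FamilyType) (κ : ℕ), ∃ x ∈ F.energies N κ,
        (x : ℂ) = E ∧ φ = F.eigenstate N κ x}) ∧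
    -- the spectrum is the set of roots of the product of Laguerre polynomials
    {E : ℂ | ∃ ψ, IsCutEigenstate N E ψ} = {E : ℂ | Polynomial.aeval E (thetaPoly N) = 0} := by
  refine ⟨brickState_linearIndependent,
    fun F κ => ⟨encard_energies N F κ, fun E hE => pos_of_mem_energies hE⟩,
    fun F κ E hE => ⟨isCutEigenstate_eigenstate hE, contains_eigenstate hE⟩,
    fun F κ E ψ h hc => exists_mem_energies_of_contains h hc,
    cutSolution_linearIndependent N, span_cutSolution N,
    fun E ψ h => mem_span_of_isCutEigenstate h, ?_⟩
  ext E
  change (∃ ψ, IsCutEigenstate N E ψ) ↔ Polynomial.aeval E (thetaPoly N) = 0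
  rw [exists_isCutEigenstate_iff, aeval_thetaPoly_eq_zero_iff]
  simp only [exists_mem_energies_iff, upperIndex_eq, solutionCount_eq]
  constructor
  · rintro ⟨F, κ, h⟩
    exact ⟨F.leadingBrick, F.maxCubic κ, h⟩
  · rintro ⟨b, m, h⟩
    -- The factors of Θ are grouped by fermionic brick instead of parity; brick and number of cubic
    -- bricks also determine the family.
    obtain ⟨F, κ, rfl, rfl⟩ := exists_leadingBrick_maxCubic_eq b m
    exact ⟨F, κ, h⟩
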